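/- **Cells.** Let $\Gamma_{\rm box}\subset\mathbb R^2$ be a compact connected set which is the closure of its interior, with $0\le x\le L$ for all $(x,y)\in\Gamma_{\rm box}$, such that $\partial\Gamma_{\rm box}=\partial\Gamma_{\rm L}\cup\partial\Gamma_{\rm R}\cup\bigcup_{k=1}^b\partial\Gamma_k$, where $\partial\Gamma_{\rm L}=\{0\}\times[-a,a]$ and $\partial\Gamma_{\rm R}=\{L\}\times[-a,a]$ with $a>0$ (the openings), and each $\partial\Gamma_k$ is an arc of a circle with center $c_k$ and radius $\rho_k>0$. The end points of the arcs and of the openings are called corners. The arcs are dispersing: near each non-corner point of $\partial\Gamma_k$ the set $\Gamma_{\rm box}$ coincides with $\{x: |x-c_k|\ge\rho_k\}$. Let $D$ be a disk with center $c=(L/2,0)$ and radius $r>0$ such that the closed disk lies in the interior of $\Gamma_{\rm box}$, and assume $[c,z]\cap\partial\Gamma_{\rm box}=\{z\}$ for every $z\in\partial\Gamma_{\rm box}$. The cell is $\Gamma=\Gamma_{\rm box}\setminus D$ ($D$ open), with boundary $\partial\Gamma=\partial\Gamma_{\rm box}\cup\partial D$. Let $I_k$ be the largest relatively open set of points $\theta\in\partial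 D$ for which there is a direction, pointing strictly outwards from $D$, such that a particle leaving $\theta$ in this direction is reflected once, specularly, at a non-corner point of $\partial\Gamma_k$ and then returns to $\theta$, meeting $\partial\Gamma$ nowhere else in between. The cell is *1-controllable* if $\bigcup_k I_k=\partial D$. **Dynamics.** The disk has an angular position $\phi$ and an angular velocity $\omega$ (both clockwise), with $\dot\phi=\omega$. Point particles do not interact with each other; they move uniformly along straight lines between collisions, are reflected specularly at the arcs, and leave the cell when they reach an opening. When a particle hits $\partial D$ with velocity $v^{\rm n}e_{\rm n}+v^{\rm t}e_{\rm t}$ ($e_{\rm n}$ the unit normal, $e_{\rm t}$ the clockwise unit tangent), then $(v^{\rm n})'=-v^{\rm n}$, $(v^{\rm t})'=\omega$, $\omega'=v^{\rm t}$, while $\phi$ is unchanged; $\omega$ is constant otherwise. Only orbits are considered in which no particle meets a corner, at most one particle is on $\partial D$ at any time, and collisions with the disk are not tangential. **Admissible initial states.** A state with $n$ particles, with positions $q_{0,i}$, velocities $v_{0,i}$ and disk variables $\phi_0,\omega_0$, is *admissible* if: (1) $q_{0,i}\in\Gamma\setminus\partial\Gamma$ and $v_{0,i}\neq0$ for all $i$;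 (2) the $i$-th particle, moving freely with specular reflections at the arcs, reaches $\partial D\cup\partial\Gamma_{\rm L}\cup\partial\Gamma_{\rm R}$ for the first time at some finite time $t_i>0$; (3) if it is then on $\partial D$, the normal component of its velocity is non-zero; (4) $t_i\ne t_j$ if $i\neq j$ and both particles are then on $\partial D$; (5) no corner is met up to and including the time $t_i$. **Admissible paths.** An *admissible path* is a continuous curve $\gamma:[0,1]\to\Gamma$ made of finitely many straight segments meeting at $\partial\Gamma$, specularly reflected where consecutive segments meet on an arc $\partial\Gamma_k$ (no law is imposed on $\partial D$), with $\gamma(s)\notin\partial\Gamma_{\rm L}\cup\partial\Gamma_{\rm R}$ for $0<s<1$, never at a corner, and nowhere tangent to $\partial D$. **Theorem.** Let a cell be 1-controllable and let $(q_{0,i},v_{0,i})_{i=1}^n,\phi_0,\omega_0$ be an admissible initial state, $n\ge0$. Then there are $n$ admissible paths $\gamma_1,\dots,\gamma_n$ with $\gamma_i(0)=q_{0,i}$, with initial direction that of $v_{0,i}$, and with $\gamma_i(1)\in\partial\Gamma_{\rm L}\cup\partial\Gamma_{\rm R}$, and there are a time $T<\infty$ and finitely many further particles (*drivers*), each injected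 into the cell through an opening at some time in $[0,T)$ with velocity pointing into the cell, such that the system of the $n$ particles and the drivers, started at time $0$ from the given state, has an orbit on $[0,T]$ as described above in which each of the $n$ particles follows its path $\gamma_i$ up to its end and leaves the cell before or at time $T$, each driver also leaves the cell before or at time $T$, and no two particles (drivers included) are ever on $\partial D$ at the same time. -/

import Mathlib

open Set Filter Topology

/-! The plane is `ℂ` with its real inner product `inner ℝ`; `z.re`, `z.im` are the coordinates. -/

/-- Specular reflection of the vector `v` at a line with normal vector `m`: the component of `v`
along `m` changes sign, the tangential component is kept. -/
noncomputable def specular (m v : ℂ) : ℂ := v - (2 * inner ℝ v m / ‖m‖ ^ 2) • m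

/-- The closed vertical segment `{(x, y) | |y| ≤ a}`. -/
def opening (x a : ℝ) : Set ℂ := {z | z.re = x ∧ |z.im| ≤ a}

/-- The end points of the openings at `x = 0` and `x = L`, and those of the arcs. -/
noncomputable def cornerSet (L a : ℝ) (b : ℕ) (ctr : Fin b → ℂ) (rad lo hi : Fin b → ℝ) : Set ℂ :=
  {z | (z.re = 0 ∨ z.re = L) ∧ |z.im| = a} ∪
    {z | ∃ k, z = circleMap (ctr k) (rad k) (lo k) ∨ z = circleMap (ctr k) (rad k) (hi k)}

/-- The geometry of a cell: a closed bounded domain `box` of width `L`, whose boundary consists of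
two vertical openings of size `2a` and of `b` arcs of circle (the `k`-th one has center `ctr k`,
radius `rad k` and polar angles in `[lo k, hi k]`), everywhere dispersing, with a disk of radius `r`
and center `(L/2, 0)` in its interior, from whose center every ray meets the boundary once. -/
structure ScattererCell where
  /-- width -/
  L : ℝ
  /-- half the size of the openings -/
  a : ℝ
  /-- radius of the disk -/
  r : ℝ
  /-- number of arcs -/
  b : ℕ
  ctr : Fin b → ℂ
  rad : Fin b → ℝ
  lo : Fin b → ℝ
  hi : Fin b → ℝ
  box : Set ℂ
  a_pos : 0 < a
  r_pos : 0 < r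
  rad_pos : ∀ k, 0 < rad k
  lo_lt_hi : ∀ k, lo k < hi k
  hi_lt : ∀ k, hi k < lo k + 2 * Real.pi
  isCompact_box : IsCompact box
  isConnected_box : IsConnected box
  closure_interior_box : closure (interior box) = box
  width : ∀ z ∈ box, 0 ≤ z.re ∧ z.re ≤ L
  frontier_box : frontier box =
    opening 0 a ∪ opening L a ∪ ⋃ k, circleMap (ctr k) (rad k) '' Icc (lo k) (hi k)
  /-- dispersing: near a point of an arc that is not a corner, the domain is the exterior of the
  circle that carries the arc -/
  dispersing : ∀ k, ∀ z ∈ circleMap (ctr k) (rad k) '' Icc (lo k) (hi k),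
    z ∉ cornerSet L a b ctr rad lo hi → ∀ᶠ x in 𝓝 z, x ∈ box ↔ rad k ≤ ‖x - ctr k‖
  disk_subset : Metric.closedBall ((L / 2 : ℝ) : ℂ) r ⊆ interior box
  ray_once : ∀ z ∈ frontier box, segment ℝ ((L / 2 : ℝ) : ℂ) z ∩ frontier box = {z}

namespace ScattererCell

variable (C : ScattererCell)

/-- The center of the disk. -/
noncomputable def c : ℂ := ((C.L / 2 : ℝ) : ℂ)

/-- The boundary of the disk. -/
noncomputable def rim : Set ℂ := Metric.sphere C.c C.r

/-- The cell `Γ`: the closed domain between the outer boundary and the disk. -/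
noncomputable def region : Set ℂ := C.box \ Metric.ball C.c C.r

/-- The boundary `∂Γ` of the cell: outer boundary and boundary of the disk. -/
noncomputable def bdry : Set ℂ := frontier C.box ∪ C.rim

/-- The union of the two openings. -/
def openings : Set ℂ := opening 0 C.a ∪ opening C.L C.a

/-- The `k`-th arc of the outer boundary. -/
noncomputable def arc (k : Fin C.b) : Set ℂ :=
  circleMap (C.ctr k) (C.rad k) '' Icc (C.lo k) (C.hi k)

/-- The corner points of the cell. -/
noncomputable def corners : Set ℂ := cornerSet C.L C.a C.b C.ctr C.rad C.lo C.hi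

/-- A particle that leaves the disk at `p` in the direction `w` (non-tangentially) hits the outer
boundary at a point of the `k`-th arc which is not a corner, is reflected there, and then returns to
the disk at `p'`; it meets the boundary of the cell nowhere else. -/
def Returns (k : Fin C.b) (p w p' : ℂ) : Prop :=
  p ∈ C.rim ∧ p' ∈ C.rim ∧ ‖w‖ = 1 ∧ 0 < inner ℝ w (p - C.c) ∧
  ∃ z ∈ C.arc k, z ∉ C.corners ∧ ∃ t₁ > (0 : ℝ), ∃ t₂ > (0 : ℝ),
    z = p + t₁ • w ∧ p' = z + t₂ • specular (z - C.ctr k) w ∧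
    openSegment ℝ p z ⊆ C.region \ C.bdry ∧ openSegment ℝ z p' ⊆ C.region \ C.bdry

/-- The illuminated segment `I_k`: the largest relatively open set of points of the boundary of the
disk from which some direction leads back to the same point after one reflection on the `k`-th
arc. -/
def illuminated (k : Fin C.b) : Set ℂ :=
  {p | p ∈ C.rim ∧ ∀ᶠ x in 𝓝[C.rim] p, ∃ w, C.Returns k x w x}

/-- The illuminated segments cover the boundary of the disk. -/
def OneControllable : Prop := ⋃ k, C.illuminated k = C.rim

end ScattererCell

/-- A state with `n` particles: positions and velocities of the particles, angular position and
angular velocity of the disk. -/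
structure CellState (n : ℕ) where
  pos : Fin n → ℂ
  vel : Fin n → ℂ
  ang : Real.Angle
  angVel : ℝ

/-- A particle in the course of time: position, and velocity just before (`vIn`) and just after
(`vOut`) each time. -/
structure Track where
  pos : ℝ → ℂ
  vIn : ℝ → ℂ
  vOut : ℝ → ℂ

/-- On the time interval `[s, e]` the motion is rectilinear and uniform just after and just before
each time, with the velocities `vOut` and `vIn` (by compactness of `[s, e]` it is made of finitely
many straight flights). -/
def Track.Flies (x : Track) (s e : ℝ) : Prop :=
  (∀ t ∈ Ico s e, ∀ᶠ u in 𝓝[>] t,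
    x.pos u = x.pos t + (u - t) • x.vOut t ∧ x.vIn u = x.vOut t ∧ x.vOut u = x.vOut t) ∧
  (∀ t ∈ Ioc s e, ∀ᶠ u in 𝓝[<] t,
    x.pos u = x.pos t + (u - t) • x.vIn t ∧ x.vIn u = x.vIn t ∧ x.vOut u = x.vIn t)

/-- The disk in the course of time: angular position, and angular velocity just before and just
after each time. Angles and angular velocities are counted clockwise. -/
structure DiskTrack where
  ang : ℝ → Real.Angle
  wIn : ℝ → ℝ
  wOut : ℝ → ℝ

/-- On `[0, T]` the disk rotates uniformly just after and just before each time. -/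
def DiskTrack.Rotates (d : DiskTrack) (T : ℝ) : Prop :=
  (∀ t ∈ Ico 0 T, ∀ᶠ u in 𝓝[>] t,
    d.ang u = d.ang t + ((d.wOut t * (u - t) : ℝ) : Real.Angle) ∧
      d.wIn u = d.wOut t ∧ d.wOut u = d.wOut t) ∧
  (∀ t ∈ Ioc 0 T, ∀ᶠ u in 𝓝[<] t,
    d.ang u = d.ang t + ((d.wIn t * (u - t) : ℝ) : Real.Angle) ∧
      d.wIn u = d.wIn t ∧ d.wOut u = d.wIn t)

namespace ScattererCell

variable (C : ScattererCell)

/-- The motion of a particle in the cell during `[s, e]`, up to the rule for the collisions with the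
disk: free flight away from the boundary, specular reflection on the arcs, no corner is met, and no
opening is met strictly between the times `s` and `e`. -/
structure Moves (x : Track) (s e : ℝ) : Prop where
  flies : x.Flies s e
  mem_region : ∀ t ∈ Icc s e, x.pos t ∈ C.region
  not_corner : ∀ t ∈ Icc s e, x.pos t ∉ C.corners
  not_opening : ∀ t ∈ Ioo s e, x.pos t ∉ C.openings
  free : ∀ t ∈ Ioo s e, x.pos t ∉ C.bdry → x.vOut t = x.vIn t
  reflects : ∀ t ∈ Ioo s e, ∀ k, x.pos t ∈ C.arc k →
    x.vOut t = specular (x.pos t - C.ctr k) (x.vIn t)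

/-- The unit normal of the disk at a point of its boundary. -/
noncomputable def en (q : ℂ) : ℂ := (C.r⁻¹ : ℝ) • (q - C.c)

/-- The clockwise unit tangent of the disk at a point of its boundary. -/
noncomputable def et (q : ℂ) : ℂ := -Complex.I * C.en q

/-- Admissible initial states: the particles are inside the cell with non-zero velocities; the
`i`-th one reaches the disk or an opening for the first time at a finite time `τ i > 0`, without
meeting a corner; it does not hit the disk tangentially; distinct particles that hit the disk do so
at distinct times. -/
def AdmissibleInitial {n : ℕ} (ξ : CellState n) : Prop :=
  (∀ i, ξ.pos i ∈ C.region \ C.bdry ∧ ξ.vel i ≠ 0) ∧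
  ∃ (τ : Fin n → ℝ) (x : Fin n → Track),
    (∀ i, 0 < τ i ∧ (x i).pos 0 = ξ.pos i ∧ (x i).vOut 0 = ξ.vel i ∧ C.Moves (x i) 0 (τ i) ∧
      (x i).pos (τ i) ∈ C.rim ∪ C.openings ∧
      (∀ t ∈ Ioo 0 (τ i), (x i).pos t ∉ C.rim ∪ C.openings) ∧
      ((x i).pos (τ i) ∈ C.rim →
        inner ℝ ((x i).vIn (τ i)) (C.en ((x i).pos (τ i))) ≠ (0 : ℝ))) ∧
    ∀ i j, i ≠ j → (x i).pos (τ i) ∈ C.rim → (x j).pos (τ j) ∈ C.rim → τ i ≠ τ j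

/-- An orbit of the system during `[0, T]`, with particles indexed by `ι`. The particle `i` is in
the cell from the time `birth i` until the time `death i` at which it reaches an opening and leaves.
At most one particle at a time is on the disk, and collisions with the disk are not tangential. -/
structure Orbit (ι : Type) where
  T : ℝ
  disk : DiskTrack
  track : ι → Track
  birth : ι → ℝ
  death : ι → ℝ
  T_pos : 0 < T
  rotates : disk.Rotates T
  birth_nonneg : ∀ i, 0 ≤ birth i
  birth_lt_death : ∀ i, birth i < death i
  death_le : ∀ i, death i ≤ T
  moves : ∀ i, C.Moves (track i) (birth i) (death i)
  exits : ∀ i, (track i).pos (death i) ∈ C.openings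
  /-- collision with the disk: the normal velocity changes sign, the tangential velocity of the
  particle and the angular velocity of the disk are exchanged -/
  collides : ∀ i, ∀ t ∈ Ioo (birth i) (death i), (track i).pos t ∈ C.rim →
    inner ℝ ((track i).vIn t) (C.en ((track i).pos t)) ≠ (0 : ℝ) ∧
    (track i).vOut t =
      (-(inner ℝ ((track i).vIn t) (C.en ((track i).pos t)) : ℝ)) • C.en ((track i).pos t) +
        disk.wIn t • C.et ((track i).pos t) ∧
    disk.wOut t = inner ℝ ((track i).vIn t) (C.et ((track i).pos t))
  not_simultaneous : ∀ i j, i ≠ j → ∀ t ∈ Ioo (birth i) (death i), t ∈ Ioo (birth j) (death j) →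
    ¬ ((track i).pos t ∈ C.rim ∧ (track j).pos t ∈ C.rim)
  /-- the disk keeps its angular velocity when no particle hits it -/
  inertia : ∀ t ∈ Ioc 0 T, (∀ i, t ∈ Ioo (birth i) (death i) → (track i).pos t ∉ C.rim) →
    disk.wOut t = disk.wIn t

/-- Admissible paths. The path is `toFun` on `[0, 1]`; it is made of the `m` straight segments
parameterized by `[node i, node (i + 1)]`, `i < m`, with unit directions `dir i`. -/
structure AdmissiblePath where
  toFun : ℝ → ℂ
  m : ℕ
  node : ℕ → ℝ
  dir : ℕ → ℂ
  m_pos : 0 < m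
  node_zero : node 0 = 0
  node_last : node m = 1
  node_lt : ∀ i < m, node i < node (i + 1)
  norm_dir : ∀ i < m, ‖dir i‖ = 1
  continuousOn : ContinuousOn toFun (Icc 0 1)
  straight : ∀ i < m, ∃ h : ℝ → ℝ, StrictMonoOn h (Icc (node i) (node (i + 1))) ∧
    DifferentiableOn ℝ h (Ioo (node i) (node (i + 1))) ∧
    ∀ s ∈ Icc (node i) (node (i + 1)), toFun s = toFun (node i) + h s • dir i
  mem_region : ∀ s ∈ Icc (0 : ℝ) 1, toFun s ∈ C.region
  /-- consecutive segments meet at the boundary of the cell -/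
  meets : ∀ i, i + 1 < m → toFun (node (i + 1)) ∈ C.bdry
  /-- equal angles on the outer boundary -/
  reflects : ∀ i, i + 1 < m → ∀ k, toFun (node (i + 1)) ∈ C.arc k →
    dir (i + 1) = specular (toFun (node (i + 1)) - C.ctr k) (dir i)
  not_opening : ∀ s ∈ Ioo (0 : ℝ) 1, toFun s ∉ C.openings
  not_corner : ∀ s ∈ Icc (0 : ℝ) 1, toFun s ∉ C.corners
  /-- nowhere tangent to the boundary of the disk -/
  not_tangent : ∀ i < m, ∀ s ∈ Icc (node i) (node (i + 1)), toFun s ∈ C.rim →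
    inner ℝ (dir i) (toFun s - C.c) ≠ (0 : ℝ)

/-- Admissible movies: `n` admissible paths that end at the openings, and an orbit of the system
with `n` tracers and finitely many drivers, in which the tracers follow the paths up to their ends.
The drivers are injected through the openings, with velocities pointing into the cell. -/
structure AdmissibleMovie (n : ℕ) where
  path : Fin n → C.AdmissiblePath
  /-- number of drivers -/
  drivers : ℕ
  orbit : C.Orbit (Fin n ⊕ Fin drivers)
  path_end : ∀ i, (path i).toFun 1 ∈ C.openings
  tracer_birth : ∀ i, orbit.birth (Sum.inl i) = 0
  tracer_start : ∀ i, (orbit.track (Sum.inl i)).pos 0 = (path i).toFun 0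
  tracer_direction : ∀ i, ∃ v > (0 : ℝ), (orbit.track (Sum.inl i)).vOut 0 = v • (path i).dir 0
  tracer_follows : ∀ i, ∃ σ : ℝ → ℝ, ContinuousOn σ (Icc 0 (orbit.death (Sum.inl i))) ∧
    StrictMonoOn σ (Icc 0 (orbit.death (Sum.inl i))) ∧
    σ 0 = 0 ∧ σ (orbit.death (Sum.inl i)) = 1 ∧
    ∀ t ∈ Icc 0 (orbit.death (Sum.inl i)),
      (orbit.track (Sum.inl i)).pos t = (path i).toFun (σ t)
  driver_injected : ∀ j,
    ((orbit.track (Sum.inr j)).pos (orbit.birth (Sum.inr j)) ∈ opening 0 C.a ∧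
      0 < ((orbit.track (Sum.inr j)).vOut (orbit.birth (Sum.inr j))).re) ∨
    ((orbit.track (Sum.inr j)).pos (orbit.birth (Sum.inr j)) ∈ opening C.L C.a ∧
      ((orbit.track (Sum.inr j)).vOut (orbit.birth (Sum.inr j))).re < 0)

end ScattererCell

/-!
A tracer that hits the disk with normal velocity `-u` leaves it with normal velocity `u` and with a
tangential velocity equal to the angular velocity that the disk had before. So, if that angular
velocity can be prescribed before each collision, a tracer can be sent from the disk in any outward
direction.

It can indeed be prescribed: a very fast particle (driver) sent through the right opening almost
horizontally reaches the disk at its point closest to that opening and leaves almost horizontally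
through the same opening, however the disk was rotating, since its large normal velocity dominates.
Its tangential velocity, which is arbitrary, becomes the angular velocity of the disk. This takes an
arbitrarily short time (`ScattererCell.exists_driver`), so that one driver can be inserted before
each collision of a tracer.

It remains to lead each tracer from its first collision to an opening, by choosing its direction
after each collision, in such a way that no two tracers hit the disk at the same time. From a point
of the illuminated segment `I_k` a particle can return to its starting point, and this happens by an
orthogonal reflection on the `k`-th arc (`ScattererCell.Returns.exists_foot`). By the intermediate
value theorem, particles can then go from any point to any other point of a neighborhood on the disk
with one reflection (`ScattererCell.exists_nhds_escapes`). The time of the flight is an analytic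
function of the point of reflection, and it is not constant (`ScattererCell.exists_time_ne`);
therefore finitely many instants of arrival can be avoided. Hence the relative interior of the set
of the points of the disk from which a particle can escape, with any initial normal velocity and
avoiding any finite set of instants, is open and closed in the boundary of the disk. It contains the
point closest to the right opening, so by connectedness it is the whole boundary
(`ScattererCell.OneControllable.escapes`). The tracers are then treated one after the other, each
one avoiding the instants of collision of the previous ones
(`ScattererCell.OneControllable.exists_tours`).

That segments near the outer boundary are unobstructed follows from the dispersing property near the
arcs, and from the fact that every ray from the center of the disk meets the outer boundary once.
-/

/-! ### Concatenation of motions -/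

/-- The motion that follows `x` up to the time `m` and `y` afterwards. -/
noncomputable def Track.glue (x y : Track) (m : ℝ) : Track where
  pos t := if t ≤ m then x.pos t else y.pos t
  vIn t := if t ≤ m then x.vIn t else y.vIn t
  vOut t := if t < m then x.vOut t else y.vOut t

/-- The uniform motion with velocity `v` that is at `p` at the time `s`. -/
noncomputable def Track.straight (p v : ℂ) (s : ℝ) : Track where
  pos t := p + (t - s) • v
  vIn _ := v
  vOut _ := v

namespace Track

variable {x y : Track} {s m e t : ℝ}

lemma glue_pos_of_le (h : t ≤ m) : (x.glue y m).pos t = x.pos t := if_pos h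

lemma glue_vIn_of_le (h : t ≤ m) : (x.glue y m).vIn t = x.vIn t := if_pos h

lemma glue_vOut_of_lt (h : t < m) : (x.glue y m).vOut t = x.vOut t := if_pos h

lemma glue_vIn_of_gt (h : m < t) : (x.glue y m).vIn t = y.vIn t := if_neg (not_le.2 h)

lemma glue_vOut_of_ge (h : m ≤ t) : (x.glue y m).vOut t = y.vOut t := if_neg (not_lt.2 h)

lemma glue_pos_of_gt (h : m < t) : (x.glue y m).pos t = y.pos t := if_neg (not_le.2 h)

lemma glue_pos_of_ge (hp : x.pos m = y.pos m) (h : m ≤ t) : (x.glue y m).pos t = y.pos t := by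
  rcases h.eq_or_lt with rfl | h
  · rw [glue_pos_of_le le_rfl, hp]
  · exact glue_pos_of_gt h

lemma Flies.glue (hx : x.Flies s m) (hy : y.Flies m e) (hp : x.pos m = y.pos m) :
    (x.glue y m).Flies s e := by
  constructor
  · intro t ht
    rcases lt_or_ge t m with h | h
    · filter_upwards [hx.1 t ⟨ht.1, h⟩, Ioo_mem_nhdsGT h] with u hu hum
      rw [glue_pos_of_le hum.2.le, glue_pos_of_le h.le, glue_vOut_of_lt h, glue_vIn_of_le hum.2.le,
        glue_vOut_of_lt hum.2]
      exact hu
    · filter_upwards [hy.1 t ⟨h, ht.2⟩, self_mem_nhdsWithin] with u hu hum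
      have hmu : m < u := h.trans_lt hum
      rw [glue_pos_of_gt hmu, glue_pos_of_ge hp h, glue_vOut_of_ge h, glue_vIn_of_gt hmu,
        glue_vOut_of_ge hmu.le]
      exact hu
  · intro t ht
    rcases le_or_gt t m with h | h
    · filter_upwards [hx.2 t ⟨ht.1, h⟩, self_mem_nhdsWithin] with u hu hum
      have hum : u < m := lt_of_lt_of_le hum h
      rw [glue_pos_of_le hum.le, glue_pos_of_le h, glue_vIn_of_le h, glue_vIn_of_le hum.le,
        glue_vOut_of_lt hum]
      exact hu
    · filter_upwards [hy.2 t ⟨h, ht.2⟩, Ioo_mem_nhdsLT h] with u hu hum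
      rw [glue_pos_of_gt hum.1, glue_pos_of_gt h, glue_vIn_of_gt h, glue_vIn_of_gt hum.1,
        glue_vOut_of_ge hum.1.le]
      exact hu

lemma flies_straight (p v : ℂ) (t₀ s e : ℝ) : (straight p v t₀).Flies s e := by
  constructor <;>
  · intro t _
    refine Eventually.of_forall fun u => ⟨?_, rfl, rfl⟩
    simp only [straight, add_assoc, ← add_smul]
    congr 2
    ring

end Track

namespace ScattererCell

variable {C : ScattererCell} {x y : Track} {s m e : ℝ}

/-- Two admissible motions that meet on an arc or on the disk at the time `m` form an admissible
motion, provided the law of reflection holds at that time if the meeting point is on an arc. -/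
lemma Moves.glue (hx : C.Moves x s m) (hy : C.Moves y m e) (hp : x.pos m = y.pos m)
    (hb : x.pos m ∈ C.bdry) (ho : x.pos m ∉ C.openings)
    (hr : ∀ k, x.pos m ∈ C.arc k → y.vOut m = specular (x.pos m - C.ctr k) (x.vIn m)) :
    C.Moves (x.glue y m) s e where
  flies := hx.flies.glue hy.flies hp
  mem_region t ht := by
    rcases le_or_gt t m with h | h
    · rw [Track.glue_pos_of_le h]; exact hx.mem_region t ⟨ht.1, h⟩
    · rw [Track.glue_pos_of_gt h]; exact hy.mem_region t ⟨h.le, ht.2⟩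
  not_corner t ht := by
    rcases le_or_gt t m with h | h
    · rw [Track.glue_pos_of_le h]; exact hx.not_corner t ⟨ht.1, h⟩
    · rw [Track.glue_pos_of_gt h]; exact hy.not_corner t ⟨h.le, ht.2⟩
  not_opening t ht := by
    rcases lt_trichotomy t m with h | rfl | h
    · rw [Track.glue_pos_of_le h.le]; exact hx.not_opening t ⟨ht.1, h⟩
    · rwa [Track.glue_pos_of_le le_rfl]
    · rw [Track.glue_pos_of_gt h]; exact hy.not_opening t ⟨h, ht.2⟩
  free t ht := by
    rcases lt_trichotomy t m with h | rfl | h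
    · rw [Track.glue_pos_of_le h.le, Track.glue_vIn_of_le h.le, Track.glue_vOut_of_lt h]
      exact hx.free t ⟨ht.1, h⟩
    · rw [Track.glue_pos_of_le le_rfl]; exact fun h => absurd hb h
    · rw [Track.glue_pos_of_gt h, Track.glue_vIn_of_gt h, Track.glue_vOut_of_ge h.le]
      exact hy.free t ⟨h, ht.2⟩
  reflects t ht := by
    rcases lt_trichotomy t m with h | rfl | h
    · rw [Track.glue_pos_of_le h.le, Track.glue_vIn_of_le h.le, Track.glue_vOut_of_lt h]
      exact hx.reflects t ⟨ht.1, h⟩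
    · rw [Track.glue_pos_of_le le_rfl, Track.glue_vIn_of_le le_rfl, Track.glue_vOut_of_ge le_rfl]
      exact hr
    · rw [Track.glue_pos_of_gt h, Track.glue_vIn_of_gt h, Track.glue_vOut_of_ge h.le]
      exact hy.reflects t ⟨h, ht.2⟩

/-- The collision of the motion `x` with the disk at the time `t` is not tangential, and it changes
the sign of the normal velocity. The tangential velocity afterwards is free: it is the angular
velocity that a driver has to give to the disk beforehand. -/
def Bounces (C : ScattererCell) (x : Track) (t : ℝ) : Prop :=
  inner ℝ (x.vIn t) (C.en (x.pos t)) ≠ (0 : ℝ) ∧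
    inner ℝ (x.vOut t) (C.en (x.pos t)) = -inner ℝ (x.vIn t) (C.en (x.pos t))

/-- `C.Tour x s e K`: during `[s, e]` the motion `x` is that of a particle which leaves the cell at
the time `e` and which collides with the disk exactly at the times in `K`. -/
structure Tour (C : ScattererCell) (x : Track) (s e : ℝ) (K : Finset ℝ) : Prop where
  lt : s < e
  moves : C.Moves x s e
  exits : x.pos e ∈ C.openings
  hits : ∀ t, t ∈ K ↔ t ∈ Ioo s e ∧ x.pos t ∈ C.rim
  bounces : ∀ t ∈ K, C.Bounces x t

/-- A motion that reaches the disk can be followed by any tour that starts there with the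
opposite normal velocity. -/
lemma Tour.glue {K : Finset ℝ} (hy : C.Tour y m e K) (hx : C.Moves x s m) (hsm : s < m)
    (hhit : ∀ t ∈ Ioo s m, x.pos t ∉ C.rim) (hp : x.pos m = y.pos m) (hrim : x.pos m ∈ C.rim)
    (ho : x.pos m ∉ C.openings) (harc : ∀ k, x.pos m ∉ C.arc k)
    (hv : inner ℝ (x.vIn m) (C.en (x.pos m)) ≠ (0 : ℝ))
    (hv' : inner ℝ (y.vOut m) (C.en (x.pos m)) = -inner ℝ (x.vIn m) (C.en (x.pos m))) :
    C.Tour (x.glue y m) s e (insert m K) where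
  lt := hsm.trans hy.lt
  moves := hx.glue hy.moves hp (Or.inr hrim) ho fun k hk => absurd hk (harc k)
  exits := by rw [Track.glue_pos_of_gt hy.lt]; exact hy.exits
  hits t := by
    rw [Finset.mem_insert, hy.hits]
    rcases lt_trichotomy t m with h | rfl | h
    · rw [Track.glue_pos_of_le h.le]
      constructor
      · rintro (rfl | ⟨h1, _⟩)
        · exact absurd h (lt_irrefl _)
        · exact absurd h1.1 (not_lt.2 h.le)
      · rintro ⟨h1, h2⟩
        exact absurd h2 (hhit t ⟨h1.1, h⟩)
    · rw [Track.glue_pos_of_le le_rfl]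
      exact ⟨fun _ => ⟨⟨hsm, hy.lt⟩, hrim⟩, fun _ => Or.inl rfl⟩
    · rw [Track.glue_pos_of_gt h]
      constructor
      · rintro (rfl | ⟨h1, h2⟩)
        · exact absurd h (lt_irrefl _)
        · exact ⟨⟨hsm.trans h, h1.2⟩, h2⟩
      · rintro ⟨h1, h2⟩
        exact Or.inr ⟨⟨h, h1.2⟩, h2⟩
  bounces t ht := by
    rcases Finset.mem_insert.1 ht with rfl | ht
    · unfold Bounces
      rw [Track.glue_pos_of_le le_rfl, Track.glue_vIn_of_le le_rfl, Track.glue_vOut_of_ge le_rfl]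
      exact ⟨hv, hv'⟩
    · have h := ((hy.hits t).1 ht).1.1
      unfold Bounces
      rw [Track.glue_pos_of_gt h, Track.glue_vIn_of_gt h, Track.glue_vOut_of_ge h.le]
      exact hy.bounces t ht

/-! ### From motions to admissible paths -/

lemma norm_specular (p v : ℂ) : ‖specular p v‖ = ‖v‖ := by
  rcases eq_or_ne p 0 with rfl | hp
  · simp [specular]
  have hp' : ‖p‖ ^ 2 ≠ 0 := by positivity
  have : ‖specular p v‖ ^ 2 = ‖v‖ ^ 2 := by
    unfold specular
    rw [norm_sub_sq_real, norm_smul, mul_pow, inner_smul_right, Real.norm_eq_abs, sq_abs]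
    field_simp
    ring
  exact (sq_eq_sq₀ (norm_nonneg _) (norm_nonneg _)).1 this

lemma specular_smul (a : ℝ) (p v : ℂ) : specular p (a • v) = a • specular p v := by
  unfold specular
  rw [smul_sub, inner_smul_left, smul_smul]
  congr 2
  simp
  ring

lemma specular_ne_zero {p v : ℂ} (hv : v ≠ 0) : specular p v ≠ 0 := by
  rw [← norm_ne_zero_iff, norm_specular]
  exact norm_ne_zero_iff.2 hv

/-- Node times and velocities of a decomposition of the motion `x` on `[0, e]` into finitely many
straight flights, with velocities that do change at the nodes. -/
structure Flights (x : Track) (e : ℝ) where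
  m : ℕ
  node : ℕ → ℝ
  vel : ℕ → ℂ
  m_pos : 0 < m
  node_zero : node 0 = 0
  node_last : node m = e
  node_lt : ∀ i < m, node i < node (i + 1)
  vel_ne_zero : ∀ i < m, vel i ≠ 0
  vOut_eq : ∀ i < m, ∀ t ∈ Ico (node i) (node (i + 1)), x.vOut t = vel i
  vIn_eq : ∀ i < m, ∀ t ∈ Ioc (node i) (node (i + 1)), x.vIn t = vel i
  pos_eq : ∀ i < m, ∀ t ∈ Icc (node i) (node (i + 1)), x.pos t = x.pos (node i) + (t - node i) • vel i
  vel_ne : ∀ i, i + 1 < m → vel i ≠ vel (i + 1)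

namespace Flights

variable {t t' : ℝ}

/-- Prolongation of the last flight. -/
def extend (f : Flights x t) (h : t < t') (v : ℂ) (hv : f.vel (f.m - 1) = v)
    (hpos : ∀ u ∈ Ioc t t', x.pos u = x.pos t + (u - t) • v) (hin : ∀ u ∈ Ioc t t', x.vIn u = v)
    (hout : ∀ u ∈ Ico t t', x.vOut u = v) : Flights x t' := by
  obtain ⟨m, node, vel, m_pos, node_zero, node_last, node_lt, vel_ne_zero, vOut_eq, vIn_eq, pos_eq,
    vel_ne⟩ := f
  rcases m with _ | m
  · exact absurd m_pos (lt_irrefl 0)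
  simp only [Nat.add_sub_cancel] at hv
  have key : ∀ i < m + 1, Function.update node (m + 1) t' i = node i := fun i hi =>
    Function.update_of_ne (by omega) _ _
  have key' : ∀ i < m, Function.update node (m + 1) t' (i + 1) = node (i + 1) := fun i hi =>
    key _ (by omega)
  have hm := node_lt m (by omega)
  rw [node_last] at hm
  refine ⟨m + 1, Function.update node (m + 1) t', vel, m_pos, ?_, ?_, ?_, vel_ne_zero, ?_, ?_, ?_,
    vel_ne⟩
  · rw [key 0 m_pos, node_zero]
  · simp
  · intro i hi
    rw [key i hi]
    rcases Nat.lt_succ_iff_lt_or_eq.1 hi with hi' | rfl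
    · rw [key' i hi']; exact node_lt i hi
    · rw [Function.update_self]; exact hm.trans h
  · intro i hi u hu
    rw [key i hi] at hu
    rcases Nat.lt_succ_iff_lt_or_eq.1 hi with hi' | rfl
    · rw [key' i hi'] at hu; exact vOut_eq i hi u hu
    · rw [Function.update_self] at hu
      rcases lt_or_ge u t with h1 | h1
      · exact vOut_eq i hi u ⟨hu.1, by rwa [node_last]⟩
      · rw [hv, hout u ⟨h1, hu.2⟩]
  · intro i hi u hu
    rw [key i hi] at hu
    rcases Nat.lt_succ_iff_lt_or_eq.1 hi with hi' | rfl
    · rw [key' i hi'] at hu; exact vIn_eq i hi u hu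
    · rw [Function.update_self] at hu
      rcases le_or_gt u t with h1 | h1
      · exact vIn_eq i hi u ⟨hu.1, by rwa [node_last]⟩
      · rw [hv, hin u ⟨h1, hu.2⟩]
  · intro i hi u hu
    rw [key i hi] at hu ⊢
    rcases Nat.lt_succ_iff_lt_or_eq.1 hi with hi' | rfl
    · rw [key' i hi'] at hu; exact pos_eq i hi u hu
    · rw [Function.update_self] at hu
      rcases le_or_gt u t with h1 | h1
      · exact pos_eq i hi u ⟨hu.1, by rwa [node_last]⟩
      · rw [hpos u ⟨h1, hu.2⟩, pos_eq i hi t ⟨hm.le, node_last.ge⟩, hv, add_assoc, ← add_smul]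
        congr 2
        ring

/-- Addition of a flight with a new velocity. -/
def append (f : Flights x t) (h : t < t') (v : ℂ) (hv0 : v ≠ 0) (hv : f.vel (f.m - 1) ≠ v)
    (hpos : ∀ u ∈ Ioc t t', x.pos u = x.pos t + (u - t) • v) (hin : ∀ u ∈ Ioc t t', x.vIn u = v)
    (hout : ∀ u ∈ Ico t t', x.vOut u = v) : Flights x t' := by
  obtain ⟨m, node, vel, m_pos, node_zero, node_last, node_lt, vel_ne_zero, vOut_eq, vIn_eq, pos_eq,
    vel_ne⟩ := f
  simp only at hv
  have key : ∀ i < m + 1, Function.update node (m + 1) t' i = node i := fun i hi =>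
    Function.update_of_ne (by omega) _ _
  have key' : ∀ i < m, Function.update node (m + 1) t' (i + 1) = node (i + 1) := fun i hi =>
    key _ (by omega)
  have kv : ∀ i < m, Function.update vel m v i = vel i := fun i hi =>
    Function.update_of_ne (by omega) _ _
  refine ⟨m + 1, Function.update node (m + 1) t', Function.update vel m v, by omega, ?_, ?_, ?_, ?_,
    ?_, ?_, ?_, ?_⟩
  · rw [key 0 (by omega), node_zero]
  · simp
  · intro i hi
    rw [key i hi]
    rcases Nat.lt_succ_iff_lt_or_eq.1 hi with hi' | rfl
    · rw [key' i hi']; exact node_lt i hi'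
    · rw [Function.update_self, node_last]; exact h
  · intro i hi
    rcases Nat.lt_succ_iff_lt_or_eq.1 hi with hi' | rfl
    · rw [kv i hi']; exact vel_ne_zero i hi'
    · rwa [Function.update_self]
  · intro i hi u hu
    rw [key i hi] at hu
    rcases Nat.lt_succ_iff_lt_or_eq.1 hi with hi' | rfl
    · rw [key' i hi'] at hu; rw [kv i hi']; exact vOut_eq i hi' u hu
    · rw [Function.update_self, node_last] at hu
      rw [Function.update_self]; exact hout u hu
  · intro i hi u hu
    rw [key i hi] at hu
    rcases Nat.lt_succ_iff_lt_or_eq.1 hi with hi' | rfl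
    · rw [key' i hi'] at hu; rw [kv i hi']; exact vIn_eq i hi' u hu
    · rw [Function.update_self, node_last] at hu
      rw [Function.update_self]; exact hin u hu
  · intro i hi u hu
    rw [key i hi] at hu ⊢
    rcases Nat.lt_succ_iff_lt_or_eq.1 hi with hi' | rfl
    · rw [key' i hi'] at hu; rw [kv i hi']; exact pos_eq i hi' u hu
    · rw [Function.update_self, node_last] at hu
      rw [Function.update_self, node_last]
      rcases hu.1.eq_or_lt with rfl | h1
      · simp
      · exact hpos u ⟨h1, hu.2⟩
  · intro i hi
    rw [kv i (by omega)]
    rcases Nat.lt_succ_iff_lt_or_eq.1 hi with hi' | rfl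
    · rw [kv _ hi']; exact vel_ne i hi'
    · rw [Function.update_self]; exact hv

end Flights

/-- A single flight. -/
def Flights.single (h : 0 < e) (v : ℂ) (hv : v ≠ 0)
    (hpos : ∀ u ∈ Ioc 0 e, x.pos u = x.pos 0 + (u - 0) • v) (hin : ∀ u ∈ Ioc 0 e, x.vIn u = v)
    (hout : ∀ u ∈ Ico 0 e, x.vOut u = v) : Flights x e where
  m := 1
  node i := if i = 0 then 0 else e
  vel _ := v
  m_pos := one_pos
  node_zero := if_pos rfl
  node_last := if_neg one_ne_zero
  node_lt i hi := by obtain rfl : i = 0 := by omega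
                     simpa using h
  vel_ne_zero _ _ := hv
  vOut_eq i hi := by obtain rfl : i = 0 := by omega
                     simpa using hout
  vIn_eq i hi := by obtain rfl : i = 0 := by omega
                    simpa using hin
  pos_eq i hi t ht := by
    obtain rfl : i = 0 := by omega
    simp only [if_true, zero_add, one_ne_zero, if_false] at ht ⊢
    rcases ht.1.eq_or_lt with rfl | h
    · simp
    · exact hpos t ⟨h, ht.2⟩
  vel_ne i hi := by omega

lemma Flights.node_nonneg (f : Flights x e) : ∀ i ≤ f.m, 0 ≤ f.node i := by
  intro i
  induction i with
  | zero => exact fun _ => f.node_zero.ge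
  | succ i ih => exact fun hi => (ih (by omega)).trans (f.node_lt i (by omega)).le

lemma Flights.node_pos (f : Flights x e) {i : ℕ} (hi : i < f.m) : 0 < f.node (i + 1) :=
  (f.node_nonneg i hi.le).trans_lt (f.node_lt i hi)

lemma Flights.node_lt_end (f : Flights x e) : ∀ i < f.m, f.node i < e := by
  have key : ∀ k, ∀ i, i + k + 1 = f.m → f.node i < f.node f.m := by
    intro k
    induction k with
    | zero => exact fun i hi => hi ▸ f.node_lt i (by omega)
    | succ k ih => exact fun i hi => (f.node_lt i (by omega)).trans (ih (i + 1) (by omega))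
  exact fun i hi => (key (f.m - i - 1) i (by omega)).trans_eq f.node_last

lemma Flights.node_le_end (f : Flights x e) {i : ℕ} (hi : i ≤ f.m) : f.node i ≤ e := by
  rcases hi.eq_or_lt with h | h
  · exact (congrArg f.node h).trans_le f.node_last.le
  · exact (f.node_lt_end i h).le

lemma Flights.end_pos (f : Flights x e) : 0 < e :=
  f.node_zero.symm.trans_lt (f.node_lt_end 0 f.m_pos)

lemma Flights.continuousOn (f : Flights x e) : ContinuousOn x.pos (Icc 0 e) := by
  have key : ∀ i ≤ f.m, ContinuousOn x.pos (Icc 0 (f.node i)) := by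
    intro i
    induction i with
    | zero => intro _; rw [f.node_zero, Icc_self]; exact continuousOn_singleton _ _
    | succ i ih =>
      intro hi
      have h := f.node_lt i hi
      rw [← Icc_union_Icc_eq_Icc (f.node_nonneg i (by omega)) h.le]
      refine (ih (by omega)).union_of_isClosed ?_ isClosed_Icc isClosed_Icc
      refine ContinuousOn.congr (f := fun t => x.pos (f.node i) + (t - f.node i) • f.vel i) ?_
        (f.pos_eq i hi)
      fun_prop
  have := key f.m le_rfl
  rwa [f.node_last] at this

lemma Flights.vIn_node (f : Flights x e) {i : ℕ} (hi : i < f.m) :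
    x.vIn (f.node (i + 1)) = f.vel i :=
  f.vIn_eq i hi _ ⟨f.node_lt i hi, le_rfl⟩

lemma Flights.vOut_node (f : Flights x e) {i : ℕ} (hi : i < f.m) : x.vOut (f.node i) = f.vel i :=
  f.vOut_eq i hi _ ⟨le_rfl, f.node_lt i hi⟩

lemma Flights.vIn_end (f : Flights x e) : x.vIn e = f.vel (f.m - 1) := by
  have hm := f.m_pos
  have h := f.vIn_node (i := f.m - 1) (by omega)
  have h' : f.node (f.m - 1 + 1) = e := by rw [Nat.sub_add_cancel hm, f.node_last]
  rwa [h'] at h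

/-- A motion whose velocity never vanishes consists of finitely many straight flights: by
compactness, the velocity changes only finitely often. -/
lemma exists_flights {x : Track} {e : ℝ} (he : 0 < e) (hx : x.Flies 0 e) (h0 : x.vOut 0 ≠ 0)
    (hv0 : ∀ t ∈ Ioo 0 e, x.vIn t ≠ 0 → x.vOut t ≠ 0) : Nonempty (Flights x e) := by
  -- the set of times up to which there is such a decomposition
  set S : Set ℝ := {t | t = 0 ∨ Nonempty (Flights x t)} with hS
  have right : ∀ t ∈ S, t ∈ Ico 0 e → ∃ t' ∈ S, t' ∈ Ioc t e := by
    intro t htS ht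
    obtain ⟨l, hl, hsub⟩ := (mem_nhdsGT_iff_exists_Ioo_subset).1 (hx.1 t ht)
    have hlt : t < min ((t + l) / 2) e := lt_min (by linarith [mem_Ioi.1 hl]) ht.2
    have hll : min ((t + l) / 2) e < l := (min_le_left _ _).trans_lt (by linarith [mem_Ioi.1 hl])
    refine ⟨min ((t + l) / 2) e, Or.inr ?_, hlt, min_le_right _ _⟩
    have hpos : ∀ u ∈ Ioc t (min ((t + l) / 2) e), x.pos u = x.pos t + (u - t) • x.vOut t :=
      fun u hu => (hsub ⟨hu.1, hu.2.trans_lt hll⟩).1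
    have hin : ∀ u ∈ Ioc t (min ((t + l) / 2) e), x.vIn u = x.vOut t :=
      fun u hu => (hsub ⟨hu.1, hu.2.trans_lt hll⟩).2.1
    have hout : ∀ u ∈ Ico t (min ((t + l) / 2) e), x.vOut u = x.vOut t := by
      intro u hu
      rcases hu.1.eq_or_lt with rfl | h
      · rfl
      · exact (hsub ⟨h, hu.2.trans hll⟩).2.2
    rcases htS with rfl | ⟨⟨f⟩⟩
    · exact ⟨Flights.single hlt _ h0 hpos hin hout⟩
    · by_cases hv : f.vel (f.m - 1) = x.vOut t
      · exact ⟨f.extend hlt _ hv hpos hin hout⟩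
      · have ht0 : 0 < t := f.end_pos
        have hne : x.vIn t ≠ 0 := by
          rw [f.vIn_end]
          exact f.vel_ne_zero _ (Nat.sub_lt f.m_pos one_pos)
        exact ⟨f.append hlt _ (hv0 t ⟨ht0, ht.2⟩ hne) hv hpos hin hout⟩
  have left : ∀ t ∈ Ioc 0 e, ∃ l, 0 ≤ l ∧ l < t ∧ ∀ t' ∈ S, t' ∈ Ioo l t → t ∈ S := by
    intro t ht
    obtain ⟨l, hl, hsub⟩ := (mem_nhdsLT_iff_exists_Ioo_subset).1 (hx.2 t ht)
    refine ⟨max l 0, le_max_right _ _, max_lt hl ht.1, fun t' ht'S ht' => Or.inr ?_⟩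
    have h0 : 0 < t' := (le_max_right _ _).trans_lt ht'.1
    have hlt' : l < t' := (le_max_left _ _).trans_lt ht'.1
    rcases ht'S with rfl | ⟨⟨f⟩⟩
    · exact absurd h0 (lt_irrefl _)
    have h1 : x.pos t' = x.pos t + (t' - t) • x.vIn t ∧ x.vIn t' = x.vIn t ∧ x.vOut t' = x.vIn t :=
      hsub ⟨hlt', ht'.2⟩
    have h2 := f.vIn_end
    refine ⟨f.extend ht'.2 (x.vIn t) (h2.symm.trans h1.2.1) ?_ ?_ ?_⟩
    · intro u hu
      rcases hu.2.eq_or_lt with rfl | h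
      · rw [h1.1, add_assoc, ← add_smul]
        simp
      · rw [(hsub ⟨hlt'.trans hu.1, h⟩).1, h1.1, add_assoc, ← add_smul]
        congr 2
        ring
    · intro u hu
      rcases hu.2.eq_or_lt with rfl | h
      · rfl
      · exact (hsub ⟨hlt'.trans hu.1, h⟩).2.1
    · exact fun u hu => (hsub ⟨hlt'.trans_le hu.1, hu.2⟩).2.2
  have hbdd : BddAbove (S ∩ Icc 0 e) := bddAbove_Icc.mono inter_subset_right
  have h0 : (0 : ℝ) ∈ S ∩ Icc 0 e := ⟨Or.inl rfl, le_rfl, he.le⟩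
  have hb0 : 0 ≤ sSup (S ∩ Icc 0 e) := le_csSup hbdd h0
  have hbe : sSup (S ∩ Icc 0 e) ≤ e := csSup_le ⟨0, h0⟩ fun t ht => ht.2.2
  have hbS : sSup (S ∩ Icc 0 e) ∈ S := by
    by_contra hn
    have hpos : 0 < sSup (S ∩ Icc 0 e) := lt_of_le_of_ne hb0 fun h => hn (Or.inl h.symm)
    obtain ⟨l, _, hl, hleft⟩ := left _ ⟨hpos, hbe⟩
    obtain ⟨t', ht', hlt'⟩ := exists_lt_of_lt_csSup ⟨0, h0⟩ hl
    refine hn (hleft t' ht'.1 ⟨hlt', lt_of_le_of_ne (le_csSup hbdd ht') ?_⟩)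
    rintro h
    exact hn (h ▸ ht'.1)
  rcases hbe.eq_or_lt with h | h
  · rw [h] at hbS
    exact hbS.resolve_left he.ne'
  · obtain ⟨t', ht'S, ht'⟩ := right _ hbS ⟨hb0, h⟩
    exact absurd (le_csSup hbdd ⟨ht'S, (hb0.trans_lt ht'.1).le, ht'.2⟩) (not_le.2 ht'.1)

lemma inner_en (v q : ℂ) : inner ℝ v (C.en q) = C.r⁻¹ * inner ℝ v (q - C.c) := by
  rw [en, inner_smul_right]

lemma mem_bdry_iff {z : ℂ} :
    z ∈ C.bdry ↔ z ∈ C.openings ∨ (∃ k, z ∈ C.arc k) ∨ z ∈ C.rim := by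
  simp only [bdry, C.frontier_box, openings, arc, mem_union, mem_iUnion]
  tauto

/-- The path described by a tour, parameterized proportionally to time. -/
lemma Tour.exists_path {x : Track} {e : ℝ} {K : Finset ℝ} (hx : C.Tour x 0 e K)
    (h0 : x.vOut 0 ≠ 0) (hr : x.pos 0 ∉ C.rim) (hre : x.pos e ∉ C.rim) :
    ∃ γ : C.AdmissiblePath, (∀ s, γ.toFun s = x.pos (e * s)) ∧
      ∃ a > (0 : ℝ), x.vOut 0 = a • γ.dir 0 := by
  have hstep : ∀ t ∈ Ioo 0 e, x.vIn t ≠ 0 → x.vOut t ≠ 0 := by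
    intro t ht hv
    by_cases hb : x.pos t ∈ C.bdry
    · rcases mem_bdry_iff.1 hb with h | ⟨k, h⟩ | h
      · exact absurd h (hx.moves.not_opening t ht)
      · rw [hx.moves.reflects t ht k h]
        exact specular_ne_zero hv
      · intro h'
        have := hx.bounces t ((hx.hits t).2 ⟨ht, h⟩)
        rw [Bounces, h', inner_zero_left, eq_comm, neg_eq_zero] at this
        exact this.1 this.2
    · rwa [hx.moves.free t ht hb]
  obtain ⟨f⟩ := exists_flights hx.lt hx.moves.flies h0 hstep
  have he := hx.lt
  have hes : ∀ t, e * (t / e) = t := fun t => by field_simp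
  have hIcc : ∀ s ∈ Icc (0 : ℝ) 1, e * s ∈ Icc 0 e := fun s hs =>
    ⟨mul_nonneg he.le hs.1, mul_le_of_le_one_right he.le hs.2⟩
  have hIoo : ∀ s ∈ Ioo (0 : ℝ) 1, e * s ∈ Ioo 0 e := fun s hs =>
    ⟨mul_pos he hs.1, mul_lt_of_lt_one_right he hs.2⟩
  have hnode : ∀ i s, s ∈ Icc (f.node i / e) (f.node (i + 1) / e) →
      e * s ∈ Icc (f.node i) (f.node (i + 1)) := fun i s hs =>
    ⟨(div_le_iff₀' he).1 hs.1, (le_div_iff₀' he).1 hs.2⟩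
  have hmid : ∀ i, i + 1 < f.m → f.node (i + 1) ∈ Ioo 0 e := fun i hi =>
    ⟨f.node_pos (by omega), f.node_lt_end _ hi⟩
  have hnorm : ∀ i < f.m, 0 < ‖f.vel i‖ := fun i hi => norm_pos_iff.2 (f.vel_ne_zero i hi)
  refine ⟨{ toFun := fun s => x.pos (e * s)
            m := f.m
            node := fun i => f.node i / e
            dir := fun i => ‖f.vel i‖⁻¹ • f.vel i
            m_pos := f.m_pos
            node_zero := by rw [f.node_zero, zero_div]
            node_last := by rw [f.node_last, div_self he.ne']
            node_lt := fun i hi => div_lt_div_of_pos_right (f.node_lt i hi) he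
            norm_dir := fun i hi => by
              rw [norm_smul, norm_inv, norm_norm, inv_mul_cancel₀ (hnorm i hi).ne']
            continuousOn := f.continuousOn.comp (by fun_prop) hIcc
            straight := ?_
            mem_region := fun s hs => hx.moves.mem_region _ (hIcc s hs)
            meets := ?_
            reflects := ?_
            not_opening := fun s hs => hx.moves.not_opening _ (hIoo s hs)
            not_corner := fun s hs => hx.moves.not_corner _ (hIcc s hs)
            not_tangent := ?_ }, fun _ => rfl, ‖f.vel 0‖, hnorm 0 f.m_pos, ?_⟩
  · intro i hi
    refine ⟨fun s => (e * s - f.node i) * ‖f.vel i‖, ?_, by fun_prop, ?_⟩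
    · intro s _ s' _ h
      have := hnorm i hi
      simp only
      gcongr
    · intro s hs
      rw [hes, f.pos_eq i hi _ (hnode i s hs), mul_smul, smul_inv_smul₀ (hnorm i hi).ne']
  · intro i hi
    rw [hes]
    by_contra hb
    have := hx.moves.free _ (hmid i hi) hb
    rw [f.vIn_node (by omega), f.vOut_node hi] at this
    exact f.vel_ne i hi this.symm
  · intro i hi k hk
    rw [hes] at hk ⊢
    have := hx.moves.reflects _ (hmid i hi) k hk
    rw [f.vIn_node (by omega), f.vOut_node hi] at this
    rw [this, norm_specular, specular_smul]
  · intro i hi s hs hrim hinner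
    have ht := hnode i s hs
    have h0' : e * s ≠ 0 := fun h => hr (h ▸ hrim)
    have he' : e * s ≠ e := fun h => hre (h ▸ hrim)
    have htI : e * s ∈ Ioo 0 e :=
      ⟨lt_of_le_of_ne ((f.node_nonneg i hi.le).trans ht.1) h0'.symm,
        lt_of_le_of_ne (ht.2.trans (f.node_le_end hi)) he'⟩
    have hb := hx.bounces _ ((hx.hits _).2 ⟨htI, hrim⟩)
    have hzero : inner ℝ (f.vel i) (C.en (x.pos (e * s))) = (0 : ℝ) := by
      rw [inner_smul_left, mul_eq_zero] at hinner
      rw [inner_en, hinner.resolve_left (by simpa using f.vel_ne_zero i hi), mul_zero]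
    rcases ht.2.eq_or_lt with h | h
    · refine hb.1 ?_
      rwa [f.vIn_eq i hi _ ⟨h ▸ f.node_lt i hi, ht.2⟩]
    · refine hb.1 (neg_eq_zero.1 ?_)
      rwa [← hb.2, f.vOut_eq i hi _ ⟨ht.1, h⟩]
  · rw [smul_inv_smul₀ (hnorm 0 f.m_pos).ne', ← f.vOut_node f.m_pos, f.node_zero]

end ScattererCell

namespace ScattererCell

variable {C : ScattererCell}

/-! ### The geometry of the cell -/

lemma c_re : C.c.re = C.L / 2 := Complex.ofReal_re _

lemma c_im : C.c.im = 0 := Complex.ofReal_im _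

lemma inner_eq (v w : ℂ) : inner ℝ v w = v.re * w.re + v.im * w.im := by
  rw [Complex.inner]
  simp
  ring

lemma norm_sq_eq (v : ℂ) : ‖v‖ ^ 2 = v.re ^ 2 + v.im ^ 2 := by
  rw [Complex.sq_norm, Complex.normSq_apply]
  ring

lemma closedBall_subset_interior : Metric.closedBall C.c C.r ⊆ interior C.box := C.disk_subset

lemma rim_subset_interior : C.rim ⊆ interior C.box :=
  Metric.sphere_subset_closedBall.trans C.closedBall_subset_interior

lemma frontier_subset_box : frontier C.box ⊆ C.box := C.isCompact_box.isClosed.frontier_subset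

lemma arc_subset_frontier (k : Fin C.b) : C.arc k ⊆ frontier C.box := by
  rw [C.frontier_box]
  exact (subset_iUnion (fun k => C.arc k) k).trans subset_union_right

lemma openings_subset_frontier : C.openings ⊆ frontier C.box := by
  rw [C.frontier_box]
  exact subset_union_left

lemma corners_subset_frontier : C.corners ⊆ frontier C.box := by
  rintro z (⟨h, h'⟩ | ⟨k, h⟩)
  · refine openings_subset_frontier ?_
    rcases h with h | h
    · exact Or.inl ⟨h, h'.le⟩
    · exact Or.inr ⟨h, h'.le⟩
  · refine arc_subset_frontier k ?_
    rcases h with rfl | rfl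
    · exact ⟨_, left_mem_Icc.2 (C.lo_lt_hi k).le, rfl⟩
    · exact ⟨_, right_mem_Icc.2 (C.lo_lt_hi k).le, rfl⟩

lemma isClosed_corners : IsClosed C.corners := by
  have h1 : IsClosed {z : ℂ | (z.re = 0 ∨ z.re = C.L) ∧ |z.im| = C.a} :=
    ((isClosed_eq Complex.continuous_re continuous_const).union
      (isClosed_eq Complex.continuous_re continuous_const)).inter
      (isClosed_eq Complex.continuous_im.abs continuous_const)
  have h2 : {z : ℂ | ∃ k, z = circleMap (C.ctr k) (C.rad k) (C.lo k) ∨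
      z = circleMap (C.ctr k) (C.rad k) (C.hi k)} = ⋃ k, {circleMap (C.ctr k) (C.rad k) (C.lo k),
      circleMap (C.ctr k) (C.rad k) (C.hi k)} := by
    ext z
    simp
  refine h1.union ?_
  rw [h2]
  exact isClosed_iUnion_of_finite fun k => (Set.toFinite _).isClosed

lemma mem_region_diff_bdry_iff {z : ℂ} :
    z ∈ C.region \ C.bdry ↔ z ∈ interior C.box ∧ z ∉ Metric.closedBall C.c C.r := by
  have hcl := C.isCompact_box.isClosed
  constructor
  · rintro ⟨⟨hb, hd⟩, h⟩
    refine ⟨?_, fun h' => ?_⟩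
    · by_contra hi
      exact h (Or.inl (by rw [hcl.frontier_eq]; exact ⟨hb, hi⟩))
    · rw [← Metric.ball_union_sphere] at h'
      exact h'.elim hd fun h'' => h (Or.inr h'')
  · rintro ⟨hi, hd⟩
    refine ⟨⟨interior_subset hi, fun h => hd (Metric.ball_subset_closedBall h)⟩, ?_⟩
    rintro (h | h)
    · exact h.2 hi
    · exact hd (Metric.sphere_subset_closedBall h)

lemma frontier_subset_region : frontier C.box ⊆ C.region := fun _ hz =>
  ⟨frontier_subset_box hz,
    fun h => hz.2 (closedBall_subset_interior (Metric.ball_subset_closedBall h))⟩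

lemma rim_subset_region : C.rim ⊆ C.region := fun _ hz =>
  ⟨interior_subset (rim_subset_interior hz), fun h => Metric.sphere_disjoint_ball.le_bot ⟨hz, h⟩⟩

lemma frontier_disjoint_rim {z : ℂ} (h : z ∈ frontier C.box) : z ∉ C.rim :=
  fun h' => h.2 (rim_subset_interior h')

lemma rim_not_opening {z : ℂ} (h : z ∈ C.rim) : z ∉ C.openings :=
  fun h' => frontier_disjoint_rim (openings_subset_frontier h') h

lemma rim_not_arc {z : ℂ} (h : z ∈ C.rim) (k : Fin C.b) : z ∉ C.arc k :=
  fun h' => frontier_disjoint_rim (arc_subset_frontier k h') h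

lemma rim_not_corner {z : ℂ} (h : z ∈ C.rim) : z ∉ C.corners :=
  fun h' => frontier_disjoint_rim (corners_subset_frontier h') h

lemma norm_sub_c_of_mem_rim {z : ℂ} (h : z ∈ C.rim) : ‖z - C.c‖ = C.r := by
  rwa [rim, mem_sphere_iff_norm] at h

lemma c_mem_interior : C.c ∈ interior C.box :=
  closedBall_subset_interior (Metric.mem_closedBall_self C.r_pos.le)

lemma half_width : C.r < C.L / 2 := by
  have h : C.c + (C.r : ℂ) ∈ interior C.box := by
    refine closedBall_subset_interior ?_
    simp [abs_of_pos C.r_pos]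
  have h2 : ∀ᶠ t : ℝ in 𝓝[>] (0 : ℝ), C.c + (C.r : ℂ) + (t : ℂ) ∈ C.box := by
    have : Tendsto (fun t : ℝ => C.c + (C.r : ℂ) + (t : ℂ)) (𝓝 0) (𝓝 (C.c + (C.r : ℂ) + (0 : ℝ))) :=
      (by fun_prop : Continuous fun t : ℝ => C.c + (C.r : ℂ) + (t : ℂ)).tendsto 0
    refine (this.mono_left nhdsWithin_le_nhds).eventually (p := fun z => z ∈ C.box) ?_
    rw [Complex.ofReal_zero, add_zero]
    exact mem_interior_iff_mem_nhds.1 h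
  obtain ⟨t, ht, ht0⟩ := (h2.and self_mem_nhdsWithin).exists
  have := (C.width _ ht).2
  simp [c_re] at this
  have ht0 : 0 < t := ht0
  linarith

/-- The ray from the center of the disk to a boundary point stays in the interior of the domain
before it reaches that point. -/
lemma ray_mem_interior {z : ℂ} (hz : z ∈ frontier C.box) {l : ℝ} (h0 : 0 ≤ l) (h1 : l < 1) :
    C.c + l • (z - C.c) ∈ interior C.box := by
  have hzc : z - C.c ≠ 0 := fun h => hz.2 (by
    rw [sub_eq_zero.1 h]; exact c_mem_interior)
  have hdis : ∀ w ∈ segment ℝ C.c (C.c + l • (z - C.c)), w ∉ frontier C.box := by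
    intro w hw hwf
    rw [segment_eq_image'] at hw
    obtain ⟨t, ht, rfl⟩ := hw
    have hmem : C.c + t • (C.c + l • (z - C.c) - C.c) ∈ segment ℝ C.c z := by
      rw [segment_eq_image']
      refine ⟨t * l, ⟨mul_nonneg ht.1 h0, ?_⟩, ?_⟩
      · nlinarith [ht.1, ht.2]
      · simp [mul_smul]
    have : C.c + t • (C.c + l • (z - C.c) - C.c) ∈ ({z} : Set ℂ) := by
      rw [← C.ray_once z hz]
      exact ⟨hmem, hwf⟩
    rw [mem_singleton_iff] at this
    have h2 : (1 - t * l) • (z - C.c) = 0 := by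
      rw [add_sub_cancel_left, smul_smul] at this
      rw [sub_smul, one_smul, sub_eq_zero, sub_eq_iff_eq_add', this]
    rcases smul_eq_zero.1 h2 with h3 | h3
    · nlinarith [ht.1, ht.2]
    · exact hzc h3
  have hpre : IsPreconnected (segment ℝ C.c (C.c + l • (z - C.c))) :=
    (convex_segment _ _).isPreconnected
  have hsub := isPreconnected_iff_subset_of_disjoint.1 hpre (interior C.box) C.boxᶜ
    isOpen_interior C.isCompact_box.isClosed.isOpen_compl ?_ ?_
  · rcases hsub with h | h
    · exact h (right_mem_segment ℝ _ _)
    · exact absurd (interior_subset c_mem_interior) (h (left_mem_segment ℝ _ _))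
  · intro w hw
    by_contra hn
    rw [mem_union, not_or, mem_compl_iff, not_not] at hn
    exact hdis w hw (by rw [C.isCompact_box.isClosed.frontier_eq]; exact ⟨hn.2, hn.1⟩)
  · rw [← disjoint_iff_inter_eq_empty.1 (disjoint_compl_right (a := C.box))]
    ext w
    constructor
    · exact fun h => absurd (interior_subset h.2.1) h.2.2
    · exact fun h => absurd h.1 h.2

/-- A boundary point that is seen from the center of the disk within the angle subtended by an
opening lies on the line of that opening. -/
lemma re_eq_of_mem_frontier {X : ℝ} (hX : X = 0 ∨ X = C.L) {z : ℂ} (hz : z ∈ frontier C.box)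
    (hpos : 0 < (z.re - C.L / 2) * (X - C.L / 2))
    (hlt : |(X - C.L / 2) / (z.re - C.L / 2) * z.im| < C.a) : z.re = X := by
  have hL := C.r_pos.trans half_width
  have hw := C.width z (frontier_subset_box hz)
  have hne : z.re - C.L / 2 ≠ 0 := fun h => by simp [h] at hpos
  have hXne : X - C.L / 2 ≠ 0 := fun h => by simp [h] at hpos
  set μ := (X - C.L / 2) / (z.re - C.L / 2) with hμ
  have hμ1 : 1 ≤ μ := by
    rcases hX with rfl | rfl
    · have : z.re - C.L / 2 < 0 := by nlinarith
      rw [hμ, le_div_iff_of_neg this]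
      linarith
    · have : 0 < z.re - C.L / 2 := by nlinarith
      rw [hμ, le_div_iff₀ this]
      linarith
  have hμX : μ * (z.re - C.L / 2) = X - C.L / 2 := div_mul_cancel₀ _ hne
  set w : ℂ := C.c + μ • (z - C.c) with hwdef
  have hwre : w.re = X := by
    simp [w, c_re, hμX]
  have hwim : w.im = μ * z.im := by simp [w, c_im]
  have hwf : w ∈ frontier C.box := by
    refine openings_subset_frontier ?_
    rcases hX with rfl | rfl
    · exact Or.inl ⟨hwre, by rw [hwim]; exact hlt.le⟩
    · exact Or.inr ⟨hwre, by rw [hwim]; exact hlt.le⟩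
  have hzw : z ∈ segment ℝ C.c w ∩ frontier C.box := by
    refine ⟨?_, hz⟩
    rw [segment_eq_image']
    refine ⟨μ⁻¹, ⟨by positivity, inv_le_one_of_one_le₀ hμ1⟩, ?_⟩
    rw [hwdef, add_sub_cancel_left]
    simp only
    rw [inv_smul_smul₀ (by positivity : μ ≠ 0), add_sub_cancel]
  have := C.ray_once w hwf
  rw [c] at hzw
  rw [this, mem_singleton_iff] at hzw
  rw [hzw, hwre]

/-- An arc is nowhere vertical, so it cannot meet the relative interior of an opening. -/
lemma arc_inter_opening {X : ℝ} (hX : X = 0 ∨ X = C.L) {k : Fin C.b} {z : ℂ} (hz : z ∈ C.arc k)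
    (hre : z.re = X) : C.a ≤ |z.im| := by
  by_contra! hlt
  have hL := C.r_pos.trans half_width
  have hXne : X - C.L / 2 ≠ 0 := by
    rcases hX with rfl | rfl
    · intro h; linarith
    · intro h; linarith
  obtain ⟨φ, hφ, rfl⟩ := hz
  have hcre : Continuous fun ψ => (circleMap (C.ctr k) (C.rad k) ψ).re - C.L / 2 := by fun_prop
  have hcim : Continuous fun ψ => (circleMap (C.ctr k) (C.rad k) ψ).im := by fun_prop
  have hev : ∀ᶠ ψ in 𝓝[Ioo (C.lo k) (C.hi k)] φ,
      (circleMap (C.ctr k) (C.rad k) ψ).re = X := by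
    have e1 : ∀ᶠ ψ in 𝓝 φ,
        0 < ((circleMap (C.ctr k) (C.rad k) ψ).re - C.L / 2) * (X - C.L / 2) := by
      refine (hcre.mul continuous_const).continuousAt.eventually (lt_mem_nhds ?_)
      change 0 < ((circleMap (C.ctr k) (C.rad k) φ).re - C.L / 2) * (X - C.L / 2)
      rw [hre]
      exact mul_self_pos.2 hXne
    have e2 : ∀ᶠ ψ in 𝓝 φ, |(X - C.L / 2) / ((circleMap (C.ctr k) (C.rad k) ψ).re - C.L / 2) *
        (circleMap (C.ctr k) (C.rad k) ψ).im| < C.a := by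
      have : ContinuousAt (fun ψ => |(X - C.L / 2) /
          ((circleMap (C.ctr k) (C.rad k) ψ).re - C.L / 2) *
          (circleMap (C.ctr k) (C.rad k) ψ).im|) φ :=
        ((continuousAt_const.div hcre.continuousAt (by rwa [hre])).mul hcim.continuousAt).abs
      refine this.eventually (gt_mem_nhds ?_)
      change |(X - C.L / 2) / ((circleMap (C.ctr k) (C.rad k) φ).re - C.L / 2) *
        (circleMap (C.ctr k) (C.rad k) φ).im| < C.a
      rwa [hre, div_self hXne, one_mul]
    filter_upwards [nhdsWithin_le_nhds e1, nhdsWithin_le_nhds e2, self_mem_nhdsWithin]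
      with ψ h1 h2 hψ
    exact re_eq_of_mem_frontier hX (arc_subset_frontier k ⟨ψ, Ioo_subset_Icc_self hψ, rfl⟩) h1 h2
  have hne : (𝓝[Ioo (C.lo k) (C.hi k)] φ).NeBot := by
    rw [← mem_closure_iff_nhdsWithin_neBot, closure_Ioo (C.lo_lt_hi k).ne]
    exact hφ
  -- at some interior point of the arc the abscissa is locally constant
  obtain ⟨ψ, hψ⟩ : ∃ ψ, ∀ᶠ u in 𝓝 ψ, (circleMap (C.ctr k) (C.rad k) u).re = X := by
    obtain ⟨U, hU, hφU, hUs⟩ := mem_nhdsWithin.1 hev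
    obtain ⟨ψ, hψ⟩ := (mem_closure_iff_nhdsWithin_neBot.2 hne |> mem_closure_iff.1) U hU hφU
    exact ⟨ψ, Filter.mem_of_superset ((hU.inter isOpen_Ioo).mem_nhds hψ) hUs⟩
  have hρ := C.rad_pos k
  have h1 : ∀ u, (circleMap (C.ctr k) (C.rad k) u).re = (C.ctr k).re + C.rad k * Real.cos u := by
    intro u
    simp [circleMap, Complex.exp_re]
  have h2 : (fun u => Real.cos u) =ᶠ[𝓝 ψ] fun _ => (X - (C.ctr k).re) / C.rad k := by
    filter_upwards [hψ] with u hu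
    rw [h1] at hu
    field_simp
    linarith
  have h3 : (fun u => Real.sin u) =ᶠ[𝓝 ψ] fun _ => 0 := by
    have := h2.deriv
    filter_upwards [this] with u hu
    simpa using hu
  have h4 := h3.deriv_eq
  have h5 := h3.self_of_nhds
  simp only [Real.deriv_sin, deriv_const] at h4 h5
  have := Real.sin_sq_add_cos_sq ψ
  rw [h4, h5] at this
  norm_num at this

lemma arc_not_opening {k : Fin C.b} {z : ℂ} (hz : z ∈ C.arc k) (hc : z ∉ C.corners) :
    z ∉ C.openings := by
  rintro (⟨h, h'⟩ | ⟨h, h'⟩)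
  · exact hc (Or.inl ⟨Or.inl h, h'.antisymm (arc_inter_opening (Or.inl rfl) hz h)⟩)
  · exact hc (Or.inl ⟨Or.inr h, h'.antisymm (arc_inter_opening (Or.inr rfl) hz h)⟩)

lemma not_corner_of_lt {z : ℂ} (hre : z.re = C.L) (him : |z.im| < C.a) : z ∉ C.corners := by
  rintro (⟨_, h⟩ | ⟨k, h⟩)
  · exact him.ne h
  · refine him.not_ge (arc_inter_opening (Or.inr rfl) (k := k) ?_ hre)
    rcases h with rfl | rfl
    · exact ⟨_, left_mem_Icc.2 (C.lo_lt_hi k).le, rfl⟩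
    · exact ⟨_, right_mem_Icc.2 (C.lo_lt_hi k).le, rfl⟩

/-- The triangle spanned by the center of the disk and the right opening lies in the domain. -/
lemma mem_interior_of_cone {z : ℂ} {l : ℝ} (h0 : 0 < l) (h1 : l < 1)
    (hre : z.re = C.L / 2 + l * (C.L / 2)) (him : |z.im| ≤ l * C.a) : z ∈ interior C.box := by
  have hL := C.r_pos.trans half_width
  have hw : (⟨C.L, z.im / l⟩ : ℂ) ∈ frontier C.box := by
    refine openings_subset_frontier (Or.inr ⟨rfl, ?_⟩)
    simp only [abs_div, abs_of_pos h0]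
    rwa [div_le_iff₀' h0]
  convert ray_mem_interior hw h0.le h1 using 1
  apply Complex.ext
  · rw [Complex.add_re, c_re, Complex.smul_re, Complex.sub_re, c_re, smul_eq_mul, hre]
    ring
  · rw [Complex.add_im, c_im, Complex.smul_im, Complex.sub_im, c_im, smul_eq_mul, sub_zero,
      zero_add, mul_div_cancel₀ _ h0.ne']

lemma specular_smul_left {a : ℝ} (ha : a ≠ 0) (p v : ℂ) :
    specular (a • p) v = specular p v := by
  unfold specular
  rw [inner_smul_right, norm_smul, mul_pow, Real.norm_eq_abs, sq_abs, smul_smul]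
  congr 2
  rcases eq_or_ne p 0 with rfl | hp
  · simp
  · have : ‖p‖ ≠ 0 := norm_ne_zero_iff.2 hp
    field_simp

lemma norm_sub_ctr_of_mem_arc {k : Fin C.b} {z : ℂ} (hk : z ∈ C.arc k) :
    ‖z - C.ctr k‖ = C.rad k := by
  obtain ⟨φ, _, rfl⟩ := hk
  simp [abs_of_pos (C.rad_pos k)]

/-- Two arcs that meet at a point which is not a corner have the same law of reflection there. -/
lemma specular_eq_of_mem_arcs {k k' : Fin C.b} {z : ℂ} (hk : z ∈ C.arc k) (hk' : z ∈ C.arc k')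
    (hc : z ∉ C.corners) (v : ℂ) : specular (z - C.ctr k) v = specular (z - C.ctr k') v := by
  have e := C.dispersing k z hk hc
  have e' := C.dispersing k' z hk' hc
  have hρ := C.rad_pos k
  have hρ' := C.rad_pos k'
  have hz := norm_sub_ctr_of_mem_arc hk
  have hz' := norm_sub_ctr_of_mem_arc hk'
  set p := z - C.ctr k with hp
  set p' := z - C.ctr k' with hp'
  -- if the unit normals differ, `w` points out of the first circle and into the second one
  set w := (C.rad k)⁻¹ • p - (C.rad k')⁻¹ • p' with hw
  have hw0 : w = 0 := by
    by_contra hne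
    have hpp : inner ℝ p p = C.rad k ^ 2 := by rw [real_inner_self_eq_norm_sq, hz]
    have hpp' : inner ℝ p' p' = C.rad k' ^ 2 := by rw [real_inner_self_eq_norm_sq, hz']
    have hww : ‖w‖ ^ 2 = 2 - 2 * ((C.rad k)⁻¹ * (C.rad k')⁻¹ * inner ℝ p p') := by
      rw [hw, norm_sub_sq_real, norm_smul, norm_smul, hz, hz', inner_smul_left, inner_smul_right,
        Real.norm_of_nonneg (by positivity), Real.norm_of_nonneg (by positivity)]
      simp
      field_simp
      ring
    have hpw : inner ℝ p w = C.rad k * ‖w‖ ^ 2 / 2 := by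
      rw [hww, hw, inner_sub_right, inner_smul_right, inner_smul_right, hpp]
      field_simp
    have hpw' : inner ℝ p' w = -(C.rad k' * ‖w‖ ^ 2 / 2) := by
      rw [hww, hw, inner_sub_right, inner_smul_right, inner_smul_right, hpp', real_inner_comm]
      field_simp
      ring
    have hlim : Tendsto (fun t : ℝ => z + t • w) (𝓝[>] 0) (𝓝 z) := by
      have : Tendsto (fun t : ℝ => z + t • w) (𝓝 0) (𝓝 (z + (0 : ℝ) • w)) :=
        (by fun_prop : Continuous fun t : ℝ => z + t • w).tendsto 0
      rw [zero_smul, add_zero] at this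
      exact this.mono_left nhdsWithin_le_nhds
    obtain ⟨t, ⟨ht, ht'⟩, ht0, htρ⟩ := ((hlim.eventually (e.and e')).and (Ioo_mem_nhdsGT hρ')).exists
    have hwpos : 0 < ‖w‖ ^ 2 := by positivity
    have h1 : C.rad k ≤ ‖z + t • w - C.ctr k‖ := by
      refine (sq_le_sq₀ hρ.le (norm_nonneg _)).1 ?_
      rw [add_sub_right_comm, ← hp, norm_add_sq_real, hz, inner_smul_right, hpw]
      have : 0 ≤ t * (C.rad k * ‖w‖ ^ 2 / 2) := by positivity
      nlinarith [sq_nonneg ‖t • w‖]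
    have h2 : ‖z + t • w - C.ctr k'‖ ^ 2 < C.rad k' ^ 2 := by
      rw [add_sub_right_comm, ← hp', norm_add_sq_real, hz', inner_smul_right, hpw', norm_smul,
        mul_pow, Real.norm_eq_abs, sq_abs]
      nlinarith [mul_pos (mul_pos ht0 hwpos) (sub_pos.2 htρ)]
    have h3 := ht'.1 (ht.2 h1)
    nlinarith [norm_nonneg (z + t • w - C.ctr k')]
  have h1 : (C.rad k)⁻¹ • p = (C.rad k')⁻¹ • p' := sub_eq_zero.1 hw0
  rw [← specular_smul_left (inv_ne_zero hρ.ne') p, h1, specular_smul_left (inv_ne_zero hρ'.ne')]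

/-! ### Straight flights and reflections on an arc -/

lemma straight_mem {p q v : ℂ} {s e : ℝ} (hq : q = p + (e - s) • v)
    (hseg : openSegment ℝ p q ⊆ C.region \ C.bdry) {t₀ : ℝ} {p₀ : ℂ}
    (hp₀ : p = p₀ + (s - t₀) • v) :
    ∀ t ∈ Ioo s e, (Track.straight p₀ v t₀).pos t ∈ C.region \ C.bdry := by
  intro t ht
  have hpos : (Track.straight p₀ v t₀).pos t = p + (t - s) • v := by
    rw [hp₀, add_assoc, ← add_smul]
    simp only [Track.straight]
    congr 2
    ring
  refine hseg ?_
  rw [hpos, openSegment_eq_image', hq]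
  have hes : 0 < e - s := by linarith [ht.1, ht.2]
  refine ⟨(t - s) / (e - s), ⟨div_pos (sub_pos.2 ht.1) hes, ?_⟩, ?_⟩
  · rw [div_lt_one hes]
    linarith [ht.2]
  · simp only [add_sub_cancel_left]
    rw [smul_smul, div_mul_cancel₀ _ hes.ne']

/-- A straight flight through the interior of the cell. -/
lemma moves_straight {p q v : ℂ} {s e : ℝ} (hq : q = p + (e - s) • v)
    (hp : p ∈ C.region) (hpc : p ∉ C.corners) (hqr : q ∈ C.region) (hqc : q ∉ C.corners)
    (hseg : openSegment ℝ p q ⊆ C.region \ C.bdry) {t₀ : ℝ} {p₀ : ℂ}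
    (hp₀ : p = p₀ + (s - t₀) • v) : C.Moves (Track.straight p₀ v t₀) s e := by
  have hps : (Track.straight p₀ v t₀).pos s = p := hp₀.symm
  have hpe : (Track.straight p₀ v t₀).pos e = q := by
    rw [hq, hp₀, add_assoc, ← add_smul]
    simp only [Track.straight]
    congr 2
    ring
  have hmid := C.straight_mem hq hseg hp₀
  have hend : ∀ P : ℂ → Prop, P p → P q → (∀ z ∈ C.region \ C.bdry, P z) →
      ∀ t ∈ Icc s e, P ((Track.straight p₀ v t₀).pos t) := by
    intro P h1 h2 h3 t ht
    rcases ht.1.eq_or_lt with rfl | h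
    · rwa [hps]
    rcases ht.2.eq_or_lt with rfl | h'
    · rwa [hpe]
    · exact h3 _ (hmid t ⟨h, h'⟩)
  refine ⟨Track.flies_straight _ _ _ _ _, hend _ hp hqr fun z hz => hz.1,
    hend _ hpc hqc fun z hz h => hz.2 (Or.inl (corners_subset_frontier h)), ?_, fun _ _ _ => rfl, ?_⟩
  · exact fun t ht h => (hmid t ht).2 (Or.inl (openings_subset_frontier h))
  · exact fun t ht k h => absurd (Or.inl (arc_subset_frontier k h)) (hmid t ht).2

/-- The point `p` of the disk is such that a particle can leave the cell from there, if the angular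
velocity of the disk can be chosen at each collision: this holds for any normal velocity `u` with
which the particle starts, and any finite set `F` of instants can be avoided for the collisions. -/
def Escapes (C : ScattererCell) (p : ℂ) : Prop :=
  ∀ u > (0 : ℝ), ∀ (s : ℝ) (F : Finset ℝ), ∃ (x : Track) (e : ℝ) (K : Finset ℝ),
    C.Tour x s e K ∧ x.pos s = p ∧ inner ℝ (x.vOut s) (C.en p) = u ∧ Disjoint K F

/-- A particle can go from `p` to `p'` with one reflection on the arc `k`, if the instant of its
arrival is not forbidden. The normal distance travelled up to the reflection is `h`, hence the
flight takes the time `h / u + t * (h / u)`. -/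
lemma Escapes.of_reflection {k : Fin C.b} {p z p' : ℂ} {t h : ℝ} (hp : p ∈ C.rim)
    (hz : z ∈ C.arc k) (hzc : z ∉ C.corners) (hp' : p' ∈ C.rim) (ht : 0 < t) (hh : 0 < h)
    (hpz : openSegment ℝ p z ⊆ C.region \ C.bdry) (hzp : openSegment ℝ z p' ⊆ C.region \ C.bdry)
    (hph : inner ℝ (z - p) (C.en p) = h) (hzt : p' = z + t • specular (z - C.ctr k) (z - p))
    (hn : inner ℝ (specular (z - C.ctr k) (z - p)) (C.en p') < (0 : ℝ)) (hesc : C.Escapes p')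
    {u : ℝ} (hu : 0 < u) (s : ℝ) (F : Finset ℝ) (hF : s + (h / u + t * (h / u)) ∉ F) :
    ∃ (x : Track) (e : ℝ) (K : Finset ℝ),
      C.Tour x s e K ∧ x.pos s = p ∧ inner ℝ (x.vOut s) (C.en p) = u ∧ Disjoint K F := by
  set v := (u / h) • (z - p) with hv
  set v' := (u / h) • specular (z - C.ctr k) (z - p) with hv'
  set m := s + h / u with hm
  set e := s + (h / u + t * (h / u)) with he
  have hsm : s < m := by rw [hm]; linarith [div_pos hh hu]
  have hme : m < e := by rw [hm, he]; linarith [mul_pos ht (div_pos hh hu)]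
  have huh : u / h ≠ 0 := (div_pos hu hh).ne'
  have hzm : z = p + (m - s) • v := by
    rw [hm, hv, smul_smul, add_sub_cancel_left]
    have : h / u * (u / h) = 1 := by field_simp
    rw [this, one_smul, add_sub_cancel]
  have hpe : p' = z + (e - m) • v' := by
    rw [hm, hv', smul_smul, he, hzt]
    congr 2
    field_simp
    ring
  have hx1 : C.Moves (Track.straight p v s) s m :=
    moves_straight hzm (rim_subset_region hp) (rim_not_corner hp)
      (frontier_subset_region (arc_subset_frontier k hz)) hzc hpz (by simp)
  have hx2 : C.Moves (Track.straight z v' m) m e :=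
    moves_straight hpe (frontier_subset_region (arc_subset_frontier k hz)) hzc
      (rim_subset_region hp') (rim_not_corner hp') hzp (by simp)
  have hpos1 : (Track.straight p v s).pos m = z := hzm.symm
  have hpos2 : (Track.straight z v' m).pos m = z := by simp [Track.straight]
  have hx : C.Moves ((Track.straight p v s).glue (Track.straight z v' m) m) s e := by
    refine hx1.glue hx2 (hpos1.trans hpos2.symm) ?_ ?_ ?_
    · rw [hpos1]; exact Or.inl (arc_subset_frontier k hz)
    · rw [hpos1]; exact arc_not_opening hz hzc
    · intro k' hk'
      rw [hpos1] at hk' ⊢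
      change v' = specular _ v
      rw [hv, hv', specular_smul, specular_eq_of_mem_arcs hz hk' hzc]
  have hnohit : ∀ τ ∈ Ioo s e,
      ((Track.straight p v s).glue (Track.straight z v' m) m).pos τ ∉ C.rim := by
    intro τ hτ
    rcases lt_trichotomy τ m with h | rfl | h
    · rw [Track.glue_pos_of_le h.le]
      exact fun hr => (straight_mem hzm hpz (by simp) τ ⟨hτ.1, h⟩).2 (Or.inr hr)
    · rw [Track.glue_pos_of_le le_rfl, hpos1]
      exact frontier_disjoint_rim (arc_subset_frontier k hz)
    · rw [Track.glue_pos_of_gt h]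
      exact fun hr => (straight_mem hpe hzp (by simp) τ ⟨h, hτ.2⟩).2 (Or.inr hr)
  have hpose : ((Track.straight p v s).glue (Track.straight z v' m) m).pos e = p' := by
    rw [Track.glue_pos_of_gt hme, hpe]
    rfl
  have hvIn : ((Track.straight p v s).glue (Track.straight z v' m) m).vIn e = v' := by
    rw [Track.glue_vIn_of_gt hme]
    rfl
  have hneg : inner ℝ v' (C.en p') < (0 : ℝ) := by
    rw [hv', inner_smul_left]
    exact mul_neg_of_pos_of_neg (div_pos hu hh) hn
  obtain ⟨y, e', K, hy, hy1, hy2, hy3⟩ := hesc _ (neg_pos.2 hneg) e F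
  refine ⟨_, e', insert e K, hy.glue hx (hsm.trans hme) hnohit (hpose.trans hy1.symm) ?_ ?_ ?_ ?_ ?_,
    ?_, ?_, ?_⟩
  · rwa [hpose]
  · rw [hpose]; exact rim_not_opening hp'
  · rw [hpose]; exact rim_not_arc hp'
  · rw [hpose, hvIn]; exact hneg.ne
  · rw [hpose, hvIn]; exact hy2
  · rw [Track.glue_pos_of_le (hsm.trans hme).le, Track.glue_pos_of_le hsm.le]
    simp [Track.straight]
  · rw [Track.glue_vOut_of_lt (hsm.trans hme), Track.glue_vOut_of_lt hsm]
    change inner ℝ v _ = u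
    rw [hv, inner_smul_left, hph]
    simp
    field_simp
  · rw [Finset.disjoint_insert_left]
    exact ⟨hF, hy3⟩

/-- Description of the reflections that lead back to the starting point: the particle flies along
the normal of the arc. -/
lemma Returns.exists_foot {k : Fin C.b} {p w : ℂ} (h : C.Returns k p w p) :
    ∃ φ ∈ Ioo (C.lo k) (C.hi k), ∃ d > (0 : ℝ),
      circleMap (C.ctr k) (C.rad k) φ ∉ C.corners ∧
      p = C.ctr k + (C.rad k + d) • circleMap 0 1 φ ∧
      inner ℝ (circleMap 0 1 φ) (p - C.c) < (0 : ℝ) ∧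
      openSegment ℝ p (circleMap (C.ctr k) (C.rad k) φ) ⊆ C.region \ C.bdry := by
  obtain ⟨_, _, hw1, hwn, z, hz, hzc, t₁, ht₁, t₂, ht₂, hzp, hpz, hseg, _⟩ := h
  have hρ := C.rad_pos k
  have hdisp := C.dispersing k z hz hzc
  have hnz := norm_sub_ctr_of_mem_arc hz
  obtain ⟨φ, hφ, rfl⟩ := hz
  have hlo : C.lo k ≠ φ := by rintro rfl; exact hzc (Or.inr ⟨k, Or.inl rfl⟩)
  have hhi : φ ≠ C.hi k := by rintro rfl; exact hzc (Or.inr ⟨k, Or.inr rfl⟩)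
  set n := circleMap 0 1 φ with hn
  have hn1 : ‖n‖ = 1 := by simp [hn]
  have hzn : circleMap (C.ctr k) (C.rad k) φ = C.ctr k + C.rad k • n := by
    simp [hn, circleMap]
  set z := circleMap (C.ctr k) (C.rad k) φ with hzdef
  have hzsub : z - C.ctr k = C.rad k • n := by rw [hzn, add_sub_cancel_left]
  -- the reflected direction is opposite to the incoming one
  have h1 : t₁ • w + t₂ • specular (z - C.ctr k) w = 0 := by
    have : z + t₂ • specular (z - C.ctr k) w + t₁ • w = z := by rw [← hpz, ← hzp]
    rw [add_assoc, add_eq_left] at this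
    rw [add_comm]
    exact this
  have h2 : t₁ • w = -(t₂ • specular (z - C.ctr k) w) := eq_neg_of_add_eq_zero_left h1
  have h3 : t₁ = t₂ := by
    have := congrArg norm h2
    rw [norm_neg, norm_smul, norm_smul, norm_specular, hw1, Real.norm_of_nonneg ht₁.le,
      Real.norm_of_nonneg ht₂.le, mul_one, mul_one] at this
    exact this
  rw [← h3, ← smul_add, smul_eq_zero, or_iff_right ht₁.ne', hzsub, specular_smul_left hρ.ne'] at h1
  have h4 : w = inner ℝ w n • n := by
    have : (2 : ℝ) • w = (2 : ℝ) • (inner ℝ w n • n) := by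
      unfold specular at h1
      rw [hn1] at h1
      rw [smul_smul, two_smul, ← sub_eq_zero, ← h1]
      simp
      ring
    exact smul_right_injective ℂ (two_ne_zero' ℝ) this
  have h5 : inner ℝ w n < (0 : ℝ) := by
    by_contra! hneg
    have hlim : Tendsto (fun t : ℝ => z + t • -w) (𝓝[>] 0) (𝓝 z) := by
      have : Tendsto (fun t : ℝ => z + t • -w) (𝓝 0) (𝓝 (z + (0 : ℝ) • -w)) :=
        (by fun_prop : Continuous fun t : ℝ => z + t • -w).tendsto 0
      rw [zero_smul, add_zero] at this
      exact this.mono_left nhdsWithin_le_nhds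
    have hone : inner ℝ w n = (1 : ℝ) := by
      have := congrArg norm h4
      rw [hw1, norm_smul, hn1, mul_one, Real.norm_of_nonneg hneg] at this
      exact this.symm
    rw [hone, one_smul] at h4
    obtain ⟨t, ht, ht0, htt⟩ := ((hlim.eventually hdisp).and
      (Ioo_mem_nhdsGT (lt_min ht₁ hρ))).exists
    have hmem : z + t • -w ∈ openSegment ℝ p z := by
      rw [openSegment_symm, openSegment_eq_image']
      refine ⟨t / t₁, ⟨div_pos ht0 ht₁, (div_lt_one ht₁).2 (htt.trans_le (min_le_left _ _))⟩, ?_⟩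
      simp only
      rw [show p - z = t₁ • -w by rw [hzp]; simp, smul_smul, div_mul_cancel₀ _ ht₁.ne']
    have hbox := ht.1 (hseg hmem).1.1
    have htρ : t < C.rad k := htt.trans_le (min_le_right _ _)
    rw [add_sub_right_comm, hzsub, h4, smul_neg, ← sub_eq_add_neg, ← sub_smul, norm_smul, hn1,
      mul_one, Real.norm_of_nonneg (by linarith)] at hbox
    linarith
  have hone : inner ℝ w n = (-1 : ℝ) := by
    have := congrArg norm h4
    rw [hw1, norm_smul, hn1, mul_one, Real.norm_of_nonpos h5.le] at this
    linarith
  rw [hone, neg_one_smul] at h4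
  refine ⟨φ, ⟨lt_of_le_of_ne hφ.1 hlo, lt_of_le_of_ne hφ.2 hhi⟩, t₁, ht₁, hzc, ?_, ?_, hseg⟩
  · have : p = z - t₁ • w := by rw [hzp, add_sub_cancel_right]
    rw [this, hzn, h4, add_smul, smul_neg, sub_neg_eq_add, add_assoc]
  · rw [h4, inner_neg_left] at hwn
    linarith

end ScattererCell

namespace ScattererCell

variable (C : ScattererCell) (k : Fin C.b)

/-! ### Return to the disk after one reflection -/

/-- The direction, after reflection, of a particle that flies from `p` to the point of polar angle
`φ` on the `k`-th circle; its norm is the length of that flight. -/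
noncomputable def reflDir (p : ℂ) (φ : ℝ) : ℂ :=
  circleMap (C.ctr k) (C.rad k) φ - p -
    (2 * inner ℝ (circleMap (C.ctr k) (C.rad k) φ - p) (circleMap 0 1 φ)) • circleMap 0 1 φ

/-- The squared length of the flight from `p` to the `k`-th circle. It is the leading coefficient of
the quadratic equation for the return to the disk. -/
noncomputable def retLead (p : ℂ) (φ : ℝ) : ℝ := ‖circleMap (C.ctr k) (C.rad k) φ - p‖ ^ 2

/-- Half the linear coefficient of the quadratic equation for the return to the disk. -/
noncomputable def retHalf (p : ℂ) (φ : ℝ) : ℝ :=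
  inner ℝ (C.reflDir k p φ) (circleMap (C.ctr k) (C.rad k) φ - C.c)

/-- The constant coefficient of the quadratic equation for the return to the disk. -/
noncomputable def retConst (φ : ℝ) : ℝ := ‖circleMap (C.ctr k) (C.rad k) φ - C.c‖ ^ 2 - C.r ^ 2

/-- A quarter of the discriminant of the quadratic equation for the return to the disk. -/
noncomputable def retDisc (p : ℂ) (φ : ℝ) : ℝ :=
  C.retHalf k p φ ^ 2 - C.retLead k p φ * C.retConst k φ

/-- The length of the flight back to the disk, divided by that of the flight from `p` to the `k`-th
circle: the smaller root of the quadratic equation. -/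
noncomputable def retRatio (p : ℂ) (φ : ℝ) : ℝ :=
  (-C.retHalf k p φ - √(C.retDisc k p φ)) / C.retLead k p φ

/-- The point where the reflected particle returns to the disk. -/
noncomputable def retPoint (p : ℂ) (φ : ℝ) : ℂ :=
  circleMap (C.ctr k) (C.rad k) φ + C.retRatio k p φ • C.reflDir k p φ

variable {C k} {p : ℂ} {φ : ℝ}

lemma circleMap_eq (O : ℂ) (ρ φ : ℝ) : circleMap O ρ φ = O + ρ • circleMap 0 1 φ := by
  simp [circleMap]

lemma unit_re (φ : ℝ) : (circleMap 0 1 φ).re = Real.cos φ := by simp [circleMap, Complex.exp_re]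

lemma unit_im (φ : ℝ) : (circleMap 0 1 φ).im = Real.sin φ := by simp [circleMap, Complex.exp_im]

lemma norm_unit (φ : ℝ) : ‖circleMap 0 1 φ‖ = 1 := by simp

lemma specular_eq_reflDir :
    specular (circleMap (C.ctr k) (C.rad k) φ - C.ctr k) (circleMap (C.ctr k) (C.rad k) φ - p) =
      C.reflDir k p φ := by
  have h : circleMap (C.ctr k) (C.rad k) φ - C.ctr k = C.rad k • circleMap 0 1 φ := by
    rw [circleMap_eq (C.ctr k) (C.rad k), add_sub_cancel_left]
  rw [h, specular_smul_left (C.rad_pos k).ne', specular, norm_unit, reflDir]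
  simp

lemma norm_sq_reflDir : ‖C.reflDir k p φ‖ ^ 2 = C.retLead k p φ := by
  rw [← specular_eq_reflDir, norm_specular, retLead]

lemma retLead_ne_zero
    (h : 0 < inner ℝ (p - circleMap (C.ctr k) (C.rad k) φ) (circleMap 0 1 φ)) :
    C.retLead k p φ ≠ 0 := by
  intro h0
  rw [retLead, sq_eq_zero_iff, norm_eq_zero, sub_eq_zero] at h0
  rw [h0, sub_self, inner_zero_left] at h
  exact lt_irrefl _ h

lemma retRatio_root (hA : C.retLead k p φ ≠ 0) (hd : 0 < C.retDisc k p φ) :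
    C.retLead k p φ * C.retRatio k p φ ^ 2 + 2 * C.retHalf k p φ * C.retRatio k p φ +
      C.retConst k φ = 0 := by
  have hs := Real.sq_sqrt hd.le
  rw [retRatio]
  field_simp
  rw [retDisc] at hs ⊢
  linear_combination hs

lemma retPoint_mem_rim (hA : C.retLead k p φ ≠ 0) (hd : 0 < C.retDisc k p φ) :
    C.retPoint k p φ ∈ C.rim := by
  rw [rim, mem_sphere_iff_norm, ← sq_eq_sq₀ (norm_nonneg _) C.r_pos.le, retPoint,
    add_sub_right_comm, norm_add_sq_real, norm_smul, mul_pow, norm_sq_reflDir, inner_smul_right,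
    real_inner_comm, Real.norm_eq_abs, sq_abs]
  have h := retRatio_root hA hd
  rw [retConst] at h
  rw [retHalf] at h
  linear_combination h

lemma inner_reflDir_retPoint (hA : C.retLead k p φ ≠ 0) :
    inner ℝ (C.reflDir k p φ) (C.retPoint k p φ - C.c) = -√(C.retDisc k p φ) := by
  rw [retPoint, add_sub_right_comm, inner_add_right, inner_smul_right, real_inner_self_eq_norm_sq,
    norm_sq_reflDir]
  change C.retHalf k p φ + _ = _
  rw [retRatio]
  field_simp
  ring

lemma inner_reflDir_unit : inner ℝ (C.reflDir k p φ) (circleMap 0 1 φ) =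
    inner ℝ (p - circleMap (C.ctr k) (C.rad k) φ) (circleMap 0 1 φ) := by
  rw [reflDir, inner_sub_left (_ - p), inner_smul_left, real_inner_self_eq_norm_sq, norm_unit,
    ← neg_sub p, inner_neg_left]
  simp
  ring

/-- The value at `1` of the quadratic polynomial whose smaller root is `retRatio`, for a particle
that starts on the disk. -/
lemma ret_at_one (hp : p ∈ C.rim) :
    C.retLead k p φ + 2 * C.retHalf k p φ + C.retConst k φ =
      4 * inner ℝ (circleMap (C.ctr k) (C.rad k) φ - p) (Complex.I * circleMap 0 1 φ) *
        inner ℝ (circleMap (C.ctr k) (C.rad k) φ - C.c) (Complex.I * circleMap 0 1 φ) := by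
  have h1 := norm_sub_c_of_mem_rim hp
  have h2 := congrArg (· ^ 2) h1
  have h3 := Real.sin_sq_add_cos_sq φ
  simp only [retLead, retHalf, retConst, reflDir, norm_sq_eq, inner_eq, ← h2, Complex.sub_re,
    Complex.sub_im, Complex.smul_re, Complex.smul_im, smul_eq_mul, Complex.mul_re, Complex.mul_im,
    Complex.I_re, Complex.I_im, unit_re, unit_im]
  set a := (circleMap (C.ctr k) (C.rad k) φ).re
  set b := (circleMap (C.ctr k) (C.rad k) φ).im
  linear_combination (-4 * ((a - p.re) * (a - C.c.re) + (b - p.im) * (b - C.c.im))) * h3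

/-- The particle that hits the `k`-th arc orthogonally returns to its starting point. -/
lemma ret_at_foot {R : ℝ} (hp : p ∈ C.rim) (hpR : p = C.ctr k + R • circleMap 0 1 φ)
    (hR : C.rad k < R) (hn : inner ℝ (circleMap 0 1 φ) (p - C.c) < (0 : ℝ)) :
    C.reflDir k p φ = (R - C.rad k) • circleMap 0 1 φ ∧
    C.retLead k p φ + C.retHalf k p φ < 0 ∧ 0 < C.retDisc k p φ ∧ C.retRatio k p φ = 1 ∧
      C.retPoint k p φ = p := by
  have hv : circleMap (C.ctr k) (C.rad k) φ - p = (C.rad k - R) • circleMap 0 1 φ := by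
    rw [circleMap_eq (C.ctr k), hpR, sub_smul]
    abel
  have hd : C.reflDir k p φ = (R - C.rad k) • circleMap 0 1 φ := by
    rw [reflDir, hv, inner_smul_left, real_inner_self_eq_norm_sq, norm_unit, ← sub_smul]
    congr 1
    simp
    ring
  have hAB : C.retLead k p φ + C.retHalf k p φ = (R - C.rad k) * inner ℝ (circleMap 0 1 φ) (p - C.c) := by
    have : p - C.c = (circleMap (C.ctr k) (C.rad k) φ - C.c) + (R - C.rad k) • circleMap 0 1 φ := by
      rw [circleMap_eq (C.ctr k), hpR, sub_smul]
      abel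
    rw [retLead, retHalf, hv, hd, this, inner_add_right, inner_smul_left, inner_smul_right,
      real_inner_self_eq_norm_sq, norm_smul, norm_unit, Real.norm_eq_abs, mul_one, sq_abs]
    simp
    ring
  have hneg : C.retLead k p φ + C.retHalf k p φ < 0 := by
    rw [hAB]
    exact mul_neg_of_pos_of_neg (sub_pos.2 hR) hn
  have hq := ret_at_one (k := k) (φ := φ) hp
  have h0 : inner ℝ (circleMap (C.ctr k) (C.rad k) φ - p) (Complex.I * circleMap 0 1 φ) = (0 : ℝ) := by
    rw [hv, inner_smul_left, inner_eq]
    simp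
    ring_nf
    simp
  rw [h0] at hq
  have hdisc : C.retDisc k p φ = (C.retLead k p φ + C.retHalf k p φ) ^ 2 := by
    rw [retDisc]
    linear_combination -C.retLead k p φ * hq
  have hA : 0 < C.retLead k p φ := by
    rw [retLead, hv, norm_smul, norm_unit, Real.norm_eq_abs, mul_one, sq_abs]
    have : 0 < R - C.rad k := sub_pos.2 hR
    nlinarith
  have hratio : C.retRatio k p φ = 1 := by
    rw [retRatio, hdisc, Real.sqrt_sq_eq_abs, abs_of_neg hneg]
    field_simp
    ring
  refine ⟨hd, hneg, ?_, hratio, ?_⟩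
  · rw [hdisc]; exact sq_pos_of_neg hneg
  · rw [retPoint, hratio, one_smul, hd, circleMap_eq (C.ctr k), hpR, sub_smul]
    abel

lemma continuous_reflDir : Continuous fun q : ℂ × ℝ => C.reflDir k q.1 q.2 := by
  have h1 : Continuous (circleMap (C.ctr k) (C.rad k)) := continuous_circleMap _ _
  have h2 : Continuous (circleMap 0 1) := continuous_circleMap _ _
  unfold reflDir
  fun_prop

lemma continuous_retLead : Continuous fun q : ℂ × ℝ => C.retLead k q.1 q.2 := by
  have h1 : Continuous (circleMap (C.ctr k) (C.rad k)) := continuous_circleMap _ _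
  unfold retLead
  fun_prop

lemma continuous_retHalf : Continuous fun q : ℂ × ℝ => C.retHalf k q.1 q.2 := by
  have h1 : Continuous (circleMap (C.ctr k) (C.rad k)) := continuous_circleMap _ _
  have h2 : Continuous fun q : ℂ × ℝ => C.reflDir k q.1 q.2 := continuous_reflDir
  unfold retHalf
  fun_prop

lemma continuous_retDisc : Continuous fun q : ℂ × ℝ => C.retDisc k q.1 q.2 := by
  have h1 : Continuous (circleMap (C.ctr k) (C.rad k)) := continuous_circleMap _ _
  have h2 : Continuous fun q : ℂ × ℝ => C.retHalf k q.1 q.2 := continuous_retHalf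
  have h3 : Continuous fun q : ℂ × ℝ => C.retLead k q.1 q.2 := continuous_retLead
  unfold retDisc retConst
  fun_prop

lemma continuousAt_retRatio {q : ℂ × ℝ} (hA : C.retLead k q.1 q.2 ≠ 0) :
    ContinuousAt (fun q : ℂ × ℝ => C.retRatio k q.1 q.2) q :=
  (continuous_retHalf.neg.sub continuous_retDisc.sqrt).continuousAt.div
    continuous_retLead.continuousAt hA

lemma continuousAt_retPoint {q : ℂ × ℝ} (hA : C.retLead k q.1 q.2 ≠ 0) :
    ContinuousAt (fun q : ℂ × ℝ => C.retPoint k q.1 q.2) q := by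
  have h1 : Continuous (circleMap (C.ctr k) (C.rad k)) := continuous_circleMap _ _
  exact (h1.comp continuous_snd).continuousAt.add
    ((continuousAt_retRatio hA).smul continuous_reflDir.continuousAt)

lemma analyticAt_retRatio (hA : C.retLead k p φ ≠ 0) (hd : 0 < C.retDisc k p φ) :
    AnalyticAt ℝ (fun φ => C.retRatio k p φ) φ := by
  have h1 : ContDiff ℝ ⊤ (circleMap (C.ctr k) (C.rad k)) := contDiff_circleMap _ _
  have h2 : ContDiff ℝ ⊤ (circleMap 0 1) := contDiff_circleMap _ _
  have hv : ContDiff ℝ ⊤ fun φ => circleMap (C.ctr k) (C.rad k) φ - p := h1.sub contDiff_const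
  have hc : ContDiff ℝ ⊤ fun φ => circleMap (C.ctr k) (C.rad k) φ - C.c := h1.sub contDiff_const
  have hr : ContDiff ℝ ⊤ fun φ => C.reflDir k p φ :=
    hv.sub ((contDiff_const.mul (hv.inner ℝ h2)).smul h2)
  have hlead : ContDiff ℝ ⊤ fun φ => C.retLead k p φ := hv.norm_sq ℝ
  have hhalf : ContDiff ℝ ⊤ fun φ => C.retHalf k p φ := hr.inner ℝ hc
  have hconst : ContDiff ℝ ⊤ fun φ => C.retConst k φ := (hc.norm_sq ℝ).sub contDiff_const
  have hdisc : ContDiff ℝ ⊤ fun φ => C.retDisc k p φ := (hhalf.pow 2).sub (hlead.mul hconst)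
  exact ((hhalf.neg.contDiffAt.sub (hdisc.contDiffAt.sqrt hd.ne')).div hlead.contDiffAt hA).analyticAt

end ScattererCell

namespace ScattererCell

variable {C : ScattererCell} {k : Fin C.b} {p : ℂ} {φ : ℝ}

/-! ### Unobstructed segments -/

/-- An open neighborhood of a given point `z₀` of an arc and of the interior of the domain, in which
the points outside the circle of the arc are interior points of the domain. -/
def safeSet (C : ScattererCell) (k : Fin C.b) : Set ℂ :=
  interior C.box ∪ interior {x | x ∈ C.box ↔ C.rad k ≤ ‖x - C.ctr k‖}

lemma mem_interior_of_mem_safeSet {x : ℂ} (hx : x ∈ C.safeSet k) (hr : C.rad k < ‖x - C.ctr k‖) :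
    x ∈ interior C.box := by
  rcases hx with h | h
  · exact h
  · refine mem_interior.2 ⟨interior {x | x ∈ C.box ↔ C.rad k ≤ ‖x - C.ctr k‖} ∩
      {x | C.rad k < ‖x - C.ctr k‖}, ?_, ?_, h, hr⟩
    · rintro y ⟨hy, hy'⟩
      exact (interior_subset hy).2 hy'.le
    · exact isOpen_interior.inter (isOpen_lt continuous_const (by fun_prop))

lemma not_mem_closedBall_of_outward {w : ℂ} (hp : p ∈ C.rim) (h : 0 < inner ℝ w (p - C.c)) {s : ℝ}
    (hs : 0 < s) : p + s • w ∉ Metric.closedBall C.c C.r := by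
  rw [mem_closedBall_iff_norm, not_le]
  refine (sq_lt_sq₀ C.r_pos.le (norm_nonneg _)).1 ?_
  rw [add_sub_right_comm, norm_add_sq_real, norm_sub_c_of_mem_rim hp, inner_smul_right,
    real_inner_comm]
  have := mul_pos hs h
  nlinarith [sq_nonneg ‖s • w‖]

/-- A segment from the disk to an arc that leaves the disk outwards and reaches the circle of the
arc from outside is unobstructed as soon as it stays in the safe set. -/
lemma openSegment_subset_region {z n : ℂ} (hp : p ∈ C.rim) (h : 0 < inner ℝ (z - p) (p - C.c))
    (hz : z = C.ctr k + C.rad k • n) (hn : ‖n‖ = 1) (hpz : 0 < inner ℝ (p - z) n)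
    (hs : ∀ s ∈ Icc (0 : ℝ) 1, p + s • (z - p) ∈ C.safeSet k) :
    openSegment ℝ p z ⊆ C.region \ C.bdry := by
  rw [openSegment_eq_image']
  rintro _ ⟨s, hs', rfl⟩
  simp only
  rw [mem_region_diff_bdry_iff]
  constructor
  · refine mem_interior_of_mem_safeSet (hs s ⟨hs'.1.le, hs'.2.le⟩) ?_
    have h1 : inner ℝ (p + s • (z - p) - C.ctr k) n ≤ ‖p + s • (z - p) - C.ctr k‖ := by
      have := real_inner_le_norm (p + s • (z - p) - C.ctr k) n
      rwa [hn, mul_one] at this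
    have h2 : p + s • (z - p) - C.ctr k = (1 - s) • (p - z) + C.rad k • n := by
      rw [hz]
      simp
      ring
    have h3 : inner ℝ (p + s • (z - p) - C.ctr k) n = (1 - s) * inner ℝ (p - z) n + C.rad k := by
      rw [h2, inner_add_left, inner_smul_left, inner_smul_left, real_inner_self_eq_norm_sq, hn]
      simp
    have h4 : 0 < (1 - s) * inner ℝ (p - z) n := mul_pos (sub_pos.2 hs'.2) hpz
    linarith
  · exact not_mem_closedBall_of_outward hp h hs'.1

/-- Segments close to an unobstructed one stay in the safe set, by the tube lemma. -/
lemma eventually_segment_safe {z : ℂ} (hp : p ∈ C.rim) (hz : z ∈ C.arc k) (hzc : z ∉ C.corners)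
    (hseg : openSegment ℝ p z ⊆ C.region \ C.bdry) :
    ∀ᶠ q : ℂ × ℂ in 𝓝 (p, z), ∀ s ∈ Icc (0 : ℝ) 1, q.1 + s • (q.2 - q.1) ∈ C.safeSet k := by
  refine isCompact_Icc.eventually_forall_of_forall_eventually fun s hs => ?_
  have hopen : IsOpen (C.safeSet k) := isOpen_interior.union isOpen_interior
  have hcont : Continuous fun x : (ℂ × ℂ) × ℝ => x.1.1 + x.2 • (x.1.2 - x.1.1) := by fun_prop
  refine hcont.continuousAt.eventually (hopen.mem_nhds ?_)
  simp only
  rcases hs.1.eq_or_lt with rfl | h0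
  · rw [zero_smul, add_zero]
    exact Or.inl (rim_subset_interior hp)
  rcases hs.2.eq_or_lt with rfl | h1
  · rw [one_smul, add_sub_cancel]
    exact Or.inr (mem_interior_iff_mem_nhds.2 (C.dispersing k z hz hzc))
  · refine Or.inl (mem_region_diff_bdry_iff.1 (hseg ?_)).1
    rw [openSegment_eq_image']
    exact ⟨s, ⟨h0, h1⟩, rfl⟩

/-! ### Local controllability on the disk -/

/-- The particle that flies from `p` to the point of polar angle `φ` of the `k`-th arc is reflected
and returns to the disk, meeting no obstacle; besides, the point of return lies in the half of
the disk boundary that faces the direction `-n`. -/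
structure Feasible (C : ScattererCell) (k : Fin C.b) (n : ℂ) (p : ℂ) (φ : ℝ) : Prop where
  leaves : 0 < inner ℝ (circleMap (C.ctr k) (C.rad k) φ - p) (p - C.c)
  outside : 0 < inner ℝ (p - circleMap (C.ctr k) (C.rad k) φ) (circleMap 0 1 φ)
  disc_pos : 0 < C.retDisc k p φ
  ratio_pos : 0 < C.retRatio k p φ
  mem_Ioo : φ ∈ Ioo (C.lo k) (C.hi k)
  not_corner : circleMap (C.ctr k) (C.rad k) φ ∉ C.corners
  safe : ∀ s ∈ Icc (0 : ℝ) 1, p + s • (circleMap (C.ctr k) (C.rad k) φ - p) ∈ C.safeSet k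
  safe_ret : ∀ s ∈ Icc (0 : ℝ) 1, C.retPoint k p φ +
    s • (circleMap (C.ctr k) (C.rad k) φ - C.retPoint k p φ) ∈ C.safeSet k
  ret_side : inner ℝ (C.retPoint k p φ - C.c) n < (0 : ℝ)

/-- The normal distance from `p` to the point of the `k`-th circle of polar angle `φ`. -/
noncomputable def normalDist (C : ScattererCell) (k : Fin C.b) (p : ℂ) (φ : ℝ) : ℝ :=
  inner ℝ (circleMap (C.ctr k) (C.rad k) φ - p) (C.en p)

lemma Feasible.lead_ne_zero {n : ℂ} (h : C.Feasible k n p φ) : C.retLead k p φ ≠ 0 :=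
  retLead_ne_zero h.outside

lemma Feasible.retPoint_mem_rim {n : ℂ} (h : C.Feasible k n p φ) : C.retPoint k p φ ∈ C.rim :=
  C.retPoint_mem_rim h.lead_ne_zero h.disc_pos

lemma Feasible.mem_arc {n : ℂ} (h : C.Feasible k n p φ) :
    circleMap (C.ctr k) (C.rad k) φ ∈ C.arc k :=
  ⟨φ, Ioo_subset_Icc_self h.mem_Ioo, rfl⟩

lemma analyticAt_normalDist : AnalyticAt ℝ (fun φ => C.normalDist k p φ) φ := by
  have h1 : ContDiff ℝ ⊤ (circleMap (C.ctr k) (C.rad k)) := contDiff_circleMap _ _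
  have h2 : ContDiff ℝ ⊤ fun φ => C.normalDist k p φ :=
    (h1.sub contDiff_const).inner ℝ contDiff_const
  exact h2.contDiffAt.analyticAt

lemma Feasible.normalDist_pos {n : ℂ} (h : C.Feasible k n p φ) : 0 < C.normalDist k p φ := by
  rw [normalDist, inner_en]
  exact mul_pos (inv_pos.2 C.r_pos) h.leaves

/-- A feasible reflection transfers the possibility to escape from its end to its start, if the
instant of arrival is not forbidden. -/
lemma Feasible.escape {n : ℂ} (h : C.Feasible k n p φ) (hp : p ∈ C.rim)
    (hesc : C.Escapes (C.retPoint k p φ)) {u : ℝ} (hu : 0 < u) (s : ℝ) (F : Finset ℝ)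
    (hF : s + (C.normalDist k p φ / u + C.retRatio k p φ * (C.normalDist k p φ / u)) ∉ F) :
    ∃ (x : Track) (e : ℝ) (K : Finset ℝ),
      C.Tour x s e K ∧ x.pos s = p ∧ inner ℝ (x.vOut s) (C.en p) = u ∧ Disjoint K F := by
  have hA := h.lead_ne_zero
  have hret : C.retPoint k p φ - circleMap (C.ctr k) (C.rad k) φ =
      C.retRatio k p φ • C.reflDir k p φ := add_sub_cancel_left _ _
  have hin : inner ℝ (C.reflDir k p φ) (C.retPoint k p φ - C.c) < (0 : ℝ) := by
    rw [inner_reflDir_retPoint hA]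
    exact neg_neg_of_pos (Real.sqrt_pos.2 h.disc_pos)
  have hz := circleMap_eq (C.ctr k) (C.rad k) φ
  refine Escapes.of_reflection hp h.mem_arc h.not_corner h.retPoint_mem_rim h.ratio_pos
    h.normalDist_pos
    (openSegment_subset_region hp h.leaves hz (norm_unit φ) h.outside h.safe) ?_ rfl ?_ ?_ hesc hu
    s F hF
  · rw [openSegment_symm]
    refine openSegment_subset_region h.retPoint_mem_rim ?_ hz (norm_unit φ) ?_ h.safe_ret
    · rw [← neg_sub, hret, inner_neg_left, inner_smul_left]
      exact neg_pos.2 (mul_neg_of_pos_of_neg h.ratio_pos hin)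
    · rw [hret, inner_smul_left, inner_reflDir_unit]
      exact mul_pos h.ratio_pos h.outside
  · rw [specular_eq_reflDir, retPoint]
  · rw [specular_eq_reflDir, inner_en]
    exact mul_neg_of_pos_of_neg (inv_pos.2 C.r_pos) hin

/-- Near the orthogonal reflection all reflections are feasible. -/
lemma eventually_feasible {d : ℝ} (hp : p ∈ C.rim) (hφ : φ ∈ Ioo (C.lo k) (C.hi k)) (hd : 0 < d)
    (hc : circleMap (C.ctr k) (C.rad k) φ ∉ C.corners)
    (hpd : p = C.ctr k + (C.rad k + d) • circleMap 0 1 φ)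
    (hn : inner ℝ (circleMap 0 1 φ) (p - C.c) < (0 : ℝ))
    (hseg : openSegment ℝ p (circleMap (C.ctr k) (C.rad k) φ) ⊆ C.region \ C.bdry) :
    ∀ᶠ q : ℂ × ℝ in 𝓝 (p, φ), C.Feasible k (circleMap 0 1 φ) q.1 q.2 := by
  obtain ⟨-, -, hdisc, hratio, hret⟩ := ret_at_foot hp hpd (by linarith) hn
  have hcz : Continuous (circleMap (C.ctr k) (C.rad k)) := continuous_circleMap _ _
  have hpz : p - circleMap (C.ctr k) (C.rad k) φ = d • circleMap 0 1 φ := by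
    rw [circleMap_eq (C.ctr k), hpd, add_smul]
    abel
  have houtside : 0 < inner ℝ (p - circleMap (C.ctr k) (C.rad k) φ) (circleMap 0 1 φ) := by
    rw [hpz, inner_smul_left, real_inner_self_eq_norm_sq, norm_unit]
    simpa using hd
  have hA := retLead_ne_zero houtside
  have hz : circleMap (C.ctr k) (C.rad k) φ ∈ C.arc k := ⟨φ, Ioo_subset_Icc_self hφ, rfl⟩
  have hrp : ContinuousAt (fun q : ℂ × ℝ => C.retPoint k q.1 q.2) (p, φ) := continuousAt_retPoint hA
  have hsafe := eventually_segment_safe hp hz hc hseg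
  have e1 : ∀ᶠ q : ℂ × ℝ in 𝓝 (p, φ),
      0 < inner ℝ (circleMap (C.ctr k) (C.rad k) q.2 - q.1) (q.1 - C.c) := by
    refine (by fun_prop : Continuous fun q : ℂ × ℝ =>
      inner ℝ (circleMap (C.ctr k) (C.rad k) q.2 - q.1) (q.1 - C.c)).continuousAt.eventually
      (lt_mem_nhds ?_)
    simp only
    rw [← neg_sub, hpz, inner_neg_left, inner_smul_left]
    exact neg_pos.2 (mul_neg_of_pos_of_neg hd hn)
  have e2 : ∀ᶠ q : ℂ × ℝ in 𝓝 (p, φ),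
      0 < inner ℝ (q.1 - circleMap (C.ctr k) (C.rad k) q.2) (circleMap 0 1 q.2) :=
    (by fun_prop : Continuous fun q : ℂ × ℝ =>
      inner ℝ (q.1 - circleMap (C.ctr k) (C.rad k) q.2) (circleMap 0 1 q.2)).continuousAt.eventually
      (lt_mem_nhds houtside)
  have e3 : ∀ᶠ q : ℂ × ℝ in 𝓝 (p, φ), 0 < C.retDisc k q.1 q.2 :=
    continuous_retDisc.continuousAt.eventually (lt_mem_nhds hdisc)
  have e4 : ∀ᶠ q : ℂ × ℝ in 𝓝 (p, φ), 0 < C.retRatio k q.1 q.2 :=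
    (continuousAt_retRatio (q := (p, φ)) hA).eventually (lt_mem_nhds (one_pos.trans_eq hratio.symm))
  have e5 : ∀ᶠ q : ℂ × ℝ in 𝓝 (p, φ), q.2 ∈ Ioo (C.lo k) (C.hi k) :=
    continuous_snd.continuousAt.eventually (Ioo_mem_nhds hφ.1 hφ.2)
  have e6 : ∀ᶠ q : ℂ × ℝ in 𝓝 (p, φ), circleMap (C.ctr k) (C.rad k) q.2 ∉ C.corners :=
    ((hcz.comp continuous_snd).tendsto (p, φ)).eventually
      (isClosed_corners.isOpen_compl.mem_nhds hc)
  have e7 := ((continuous_fst.prodMk (hcz.comp continuous_snd)).tendsto (p, φ)).eventually hsafe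
  have e8 : ∀ᶠ q : ℂ × ℝ in 𝓝 (p, φ), ∀ s ∈ Icc (0 : ℝ) 1, C.retPoint k q.1 q.2 +
      s • (circleMap (C.ctr k) (C.rad k) q.2 - C.retPoint k q.1 q.2) ∈ C.safeSet k := by
    have : ContinuousAt (fun q : ℂ × ℝ =>
        (C.retPoint k q.1 q.2, circleMap (C.ctr k) (C.rad k) q.2)) (p, φ) :=
      hrp.prodMk (hcz.comp continuous_snd).continuousAt
    have h := this.tendsto
    simp only [hret] at h
    exact h.eventually hsafe
  have e9 : ∀ᶠ q : ℂ × ℝ in 𝓝 (p, φ),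
      inner ℝ (C.retPoint k q.1 q.2 - C.c) (circleMap 0 1 φ) < (0 : ℝ) := by
    have : ContinuousAt (fun q : ℂ × ℝ =>
        inner ℝ (C.retPoint k q.1 q.2 - C.c) (circleMap 0 1 φ)) (p, φ) :=
      (hrp.sub continuousAt_const).inner (𝕜 := ℝ) continuousAt_const
    refine this.eventually (gt_mem_nhds ?_)
    simp only [hret]
    rwa [real_inner_comm]
  filter_upwards [e1, e2, e3, e4, e5, e6, e7, e8, e9] with q h1 h2 h3 h4 h5 h6 h7 h8 h9
  exact ⟨h1, h2, h3, h4, h5, h6, h7, h8, h9⟩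

/-- Every point close to `p₀` lies on a normal of the circle at an angle close to `φ₀`. -/
lemma eventually_exists_foot {O p₀ : ℂ} {φ₀ R₀ ε : ℝ} (hR : 0 < R₀)
    (hp : p₀ = O + R₀ • circleMap 0 1 φ₀) (hε : 0 < ε) :
    ∀ᶠ p in 𝓝 p₀, ∃ φ ∈ Ioo (φ₀ - ε) (φ₀ + ε), ∃ R : ℝ, p = O + R • circleMap 0 1 φ := by
  set f : ℂ → ℂ := fun p => (p - O) * Complex.exp (-(φ₀ * Complex.I)) with hf
  have hexp : circleMap 0 1 φ₀ * Complex.exp (-(φ₀ * Complex.I)) = 1 := by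
    simp [circleMap, ← Complex.exp_add]
  have hf0 : f p₀ = R₀ := by
    simp only [hf]
    rw [hp, add_sub_cancel_left, Complex.real_smul, mul_assoc, hexp, mul_one]
  have hcont : ContinuousAt (fun p => (f p).arg) p₀ := by
    have hfc : ContinuousAt f p₀ := by fun_prop
    refine ContinuousAt.comp (g := Complex.arg) ?_ hfc
    rw [hf0]
    exact Complex.continuousAt_arg (Complex.ofReal_mem_slitPlane.2 hR)
  have harg : (f p₀).arg = 0 := by rw [hf0, Complex.arg_ofReal_of_nonneg hR.le]
  have hev : ∀ᶠ p in 𝓝 p₀, (f p).arg ∈ Ioo (-ε) ε := by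
    refine hcont.eventually (Ioo_mem_nhds ?_ ?_) <;> simp only [harg] <;> linarith
  filter_upwards [hev] with p hpε
  refine ⟨φ₀ + (f p).arg, ⟨by linarith [hpε.1], by linarith [hpε.2]⟩, ‖f p‖, ?_⟩
  have h1 := Complex.norm_mul_exp_arg_mul_I (f p)
  have h2 : f p * circleMap 0 1 φ₀ = p - O := by
    simp only [hf]
    rw [mul_assoc, mul_comm (Complex.exp _), hexp, mul_one]
  have h3 : circleMap 0 1 (φ₀ + (f p).arg) =
      Complex.exp ((f p).arg * Complex.I) * circleMap 0 1 φ₀ := by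
    simp [circleMap, ← Complex.exp_add]
    ring_nf
  rw [h3, Complex.real_smul, ← mul_assoc, h1, h2, add_sub_cancel]

/-- The instant of return to the disk is not a locally constant function of the point of reflection:
when that point is moved away from the foot of the normal through `p`, to the side on which the
circle recedes from the disk, both the normal distance up to the reflection and the ratio of the two
flights increase. -/
lemma exists_time_ne {R ε : ℝ} (hp : p ∈ C.rim) (hpR : p = C.ctr k + R • circleMap 0 1 φ)
    (hR : C.rad k < R) (hn : inner ℝ (circleMap 0 1 φ) (p - C.c) < (0 : ℝ)) (hε : 0 < ε) :
    ∃ ψ ∈ Ioo (φ - ε) (φ + ε), C.normalDist k p ψ * (1 + C.retRatio k p ψ) ≠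
      C.normalDist k p φ * (1 + C.retRatio k p φ) := by
  obtain ⟨-, hneg, -, hratio, -⟩ := ret_at_foot hp hpR hR hn
  have hρ := C.rad_pos k
  have hr := C.r_pos
  set b : ℝ := inner ℝ (Complex.I * circleMap 0 1 φ) (p - C.c) with hb
  -- `σ` is the side on which the circle recedes from the disk
  obtain ⟨σ, hσ, hσb⟩ : ∃ σ : ℝ, (σ = 1 ∨ σ = -1) ∧ 0 ≤ σ * b := by
    rcases le_total 0 b with h | h
    · exact ⟨1, Or.inl rfl, by simpa using h⟩
    · exact ⟨-1, Or.inr rfl, by simpa using h⟩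
  have hlead : 0 < C.retLead k p φ := by
    have : circleMap (C.ctr k) (C.rad k) φ - p = (C.rad k - R) • circleMap 0 1 φ := by
      rw [circleMap_eq (C.ctr k), hpR, sub_smul]
      abel
    rw [retLead, this, norm_smul, norm_unit, Real.norm_eq_abs, mul_one, sq_abs]
    nlinarith
  have hcont : Continuous fun τ : ℝ => (p, φ + σ * τ) := by fun_prop
  have e1 : ∀ᶠ τ in 𝓝[>] (0 : ℝ), C.retLead k p (φ + σ * τ) + C.retHalf k p (φ + σ * τ) < 0 := by
    refine nhdsWithin_le_nhds (((continuous_retLead.add continuous_retHalf).comp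
      hcont).continuousAt.eventually (gt_mem_nhds ?_))
    simpa using hneg
  have e2 : ∀ᶠ τ in 𝓝[>] (0 : ℝ), 0 < C.retLead k p (φ + σ * τ) := by
    refine nhdsWithin_le_nhds ((continuous_retLead.comp
      hcont).continuousAt.eventually (lt_mem_nhds ?_))
    simpa using hlead
  obtain ⟨τ, ⟨⟨h1, h2⟩, hτ0, hτ⟩⟩ := ((e1.and e2).and
    (Ioo_mem_nhdsGT (lt_min hε one_pos))).exists
  have hτε : τ < ε := hτ.trans_le (min_le_left _ _)
  have hτ1 : τ < 1 := hτ.trans_le (min_le_right _ _)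
  have hsin : 0 < Real.sin τ := Real.sin_pos_of_pos_of_lt_pi hτ0 (by linarith [Real.pi_gt_three])
  have hcos : 0 < Real.cos τ :=
    Real.cos_pos_of_mem_Ioo ⟨by linarith [Real.pi_gt_three], by linarith [Real.pi_gt_three]⟩
  have hcos1 : Real.cos τ < 1 := by nlinarith [Real.sin_sq_add_cos_sq τ]
  have hSσ : Real.sin (σ * τ) = σ * Real.sin τ := by rcases hσ with rfl | rfl <;> simp
  have hCσ : Real.cos (σ * τ) = Real.cos τ := by rcases hσ with rfl | rfl <;> simp
  have hσ2 : σ ^ 2 = 1 := by rcases hσ with rfl | rfl <;> norm_num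
  set a : ℝ := inner ℝ (circleMap 0 1 φ) (p - C.c) with ha
  have hS0 := Real.sin_sq_add_cos_sq φ
  have hbS : 0 ≤ σ * Real.sin τ * b := by
    have := mul_nonneg hsin.le hσb
    linarith
  have hdist : C.normalDist k p φ < C.normalDist k p (φ + σ * τ) := by
    have hid : C.normalDist k p (φ + σ * τ) - C.normalDist k p φ =
        C.r⁻¹ * (C.rad k * ((Real.cos τ - 1) * a + σ * Real.sin τ * b)) := by
      rw [normalDist, normalDist, inner_en, inner_en, ha, hb, circleMap_eq (C.ctr k),
        circleMap_eq (C.ctr k) (C.rad k) φ]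
      simp only [inner_eq, Complex.sub_re, Complex.sub_im, Complex.add_re, Complex.add_im,
        Complex.smul_re, Complex.smul_im, smul_eq_mul, Complex.mul_re, Complex.mul_im,
        Complex.I_re, Complex.I_im, unit_re, unit_im, Real.cos_add, Real.sin_add, hSσ, hCσ]
      ring
    have : 0 < (Real.cos τ - 1) * a := mul_pos_of_neg_of_neg (sub_neg.2 hcos1) hn
    have h3 : 0 < C.r⁻¹ * (C.rad k * ((Real.cos τ - 1) * a + σ * Real.sin τ * b)) := by positivity
    linarith
  have hdist0 : 0 < C.normalDist k p φ := by
    have hid : C.normalDist k p φ = C.r⁻¹ * ((R - C.rad k) * -a) := by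
      rw [normalDist, inner_en, ha, circleMap_eq (C.ctr k)]
      have : C.ctr k + C.rad k • circleMap 0 1 φ - p = (C.rad k - R) • circleMap 0 1 φ := by
        rw [hpR, sub_smul]
        abel
      rw [this, inner_smul_left, conj_trivial]
      ring
    rw [hid]
    exact mul_pos (inv_pos.2 hr) (mul_pos (sub_pos.2 hR) (neg_pos.2 hn))
  -- the quadratic polynomial is positive at `1`, and `1` lies before its vertex: so `1` lies before
  -- its smaller root
  have hone : 0 < C.retLead k p (φ + σ * τ) + 2 * C.retHalf k p (φ + σ * τ) +
      C.retConst k (φ + σ * τ) := by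
    rw [ret_at_one hp]
    have hid1 : inner ℝ (circleMap (C.ctr k) (C.rad k) (φ + σ * τ) - p)
        (Complex.I * circleMap 0 1 (φ + σ * τ)) = R * (σ * Real.sin τ) := by
      rw [circleMap_eq (C.ctr k), hpR]
      simp only [inner_eq, Complex.sub_re, Complex.sub_im, Complex.add_re, Complex.add_im,
        Complex.smul_re, Complex.smul_im, smul_eq_mul, Complex.mul_re, Complex.mul_im,
        Complex.I_re, Complex.I_im, unit_re, unit_im, Real.cos_add, Real.sin_add, hSσ, hCσ]
      linear_combination (R * (σ * Real.sin τ)) * hS0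
    have hid2 : inner ℝ (circleMap (C.ctr k) (C.rad k) (φ + σ * τ) - C.c)
        (Complex.I * circleMap 0 1 (φ + σ * τ)) =
          σ * Real.sin τ * (R - a) + Real.cos τ * b := by
      have hc : circleMap (C.ctr k) (C.rad k) (φ + σ * τ) - C.c =
          (circleMap (C.ctr k) (C.rad k) (φ + σ * τ) - p) + (p - C.c) := by abel
      rw [hc, inner_add_left, hid1, ha, hb]
      simp only [inner_eq, Complex.mul_re, Complex.mul_im,
        Complex.I_re, Complex.I_im, unit_re, unit_im, Real.cos_add, Real.sin_add, hSσ, hCσ]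
      ring
    rw [hid1, hid2]
    have h3 : 0 < R := hρ.trans hR
    have h4 : 0 < Real.sin τ ^ 2 * (R - a) := by
      have : 0 < R - a := by linarith
      positivity
    have h5 : 0 ≤ Real.cos τ * (σ * Real.sin τ * b) := mul_nonneg hcos.le hbS
    have h6 : 4 * (R * (σ * Real.sin τ)) * (σ * Real.sin τ * (R - a) + Real.cos τ * b) =
        4 * R * (Real.sin τ ^ 2 * (R - a) + Real.cos τ * (σ * Real.sin τ * b)) := by
      linear_combination (4 * R * Real.sin τ ^ 2 * (R - a)) * hσ2
    rw [h6]
    positivity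
  have hratio1 : 1 < C.retRatio k p (φ + σ * τ) := by
    rw [retRatio, lt_div_iff₀ h2, one_mul]
    have : √(C.retDisc k p (φ + σ * τ)) <
        -(C.retLead k p (φ + σ * τ) + C.retHalf k p (φ + σ * τ)) := by
      rw [Real.sqrt_lt' (by linarith), retDisc]
      nlinarith [mul_pos h2 hone]
    linarith
  refine ⟨φ + σ * τ, ?_, ne_of_gt ?_⟩
  · rcases hσ with rfl | rfl <;> constructor <;> linarith
  · rw [hratio]
    nlinarith

end ScattererCell

namespace ScattererCell

variable {C : ScattererCell} {k : Fin C.b} {p : ℂ} {φ : ℝ}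

/-- On the half of the disk boundary that faces the direction opposite to `circleMap 0 1 φ`, the
transverse coordinate determines the point. -/
lemma eq_of_mem_rim_of_inner_eq {p q : ℂ} {O : ℂ} (hp : p ∈ C.rim) (hq : q ∈ C.rim)
    (hpn : inner ℝ (p - C.c) (circleMap 0 1 φ) < (0 : ℝ))
    (hqn : inner ℝ (q - C.c) (circleMap 0 1 φ) < (0 : ℝ))
    (h : inner ℝ (p - O) (Complex.I * circleMap 0 1 φ) =
      inner ℝ (q - O) (Complex.I * circleMap 0 1 φ)) : p = q := by
  have h1 := norm_sq_eq (p - C.c)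
  have h2 := norm_sq_eq (q - C.c)
  rw [norm_sub_c_of_mem_rim hp] at h1
  rw [norm_sub_c_of_mem_rim hq] at h2
  have hS := Real.sin_sq_add_cos_sq φ
  simp only [inner_eq, Complex.sub_re, Complex.sub_im, Complex.mul_re, Complex.mul_im,
    Complex.I_re, Complex.I_im, unit_re, unit_im] at *
  set c := Real.cos φ
  set s := Real.sin φ
  have h3 : (p.re - C.c.re) * c + (p.im - C.c.im) * s = (q.re - C.c.re) * c + (q.im - C.c.im) * s := by
    have hsq : ((p.re - C.c.re) * c + (p.im - C.c.im) * s) ^ 2 =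
        ((q.re - C.c.re) * c + (q.im - C.c.im) * s) ^ 2 := by
      have h5 : (p.re - C.c.re) * -s + (p.im - C.c.im) * c =
          (q.re - C.c.re) * -s + (q.im - C.c.im) * c := by linear_combination h
      have h6 := congrArg (fun x => x ^ 2) h5
      linear_combination h2 - h1 - h6 + ((p.re - C.c.re) ^ 2 + (p.im - C.c.im) ^ 2 -
        (q.re - C.c.re) ^ 2 - (q.im - C.c.im) ^ 2) * hS
    rcases sq_eq_sq_iff_eq_or_eq_neg.1 hsq with h5 | h5
    · exact h5
    · linarith
  apply Complex.ext
  · linear_combination c * h3 - s * h + (q.re - p.re) * hS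
  · linear_combination s * h3 + c * h + (q.im - p.im) * hS

/-- Near a point of an illuminated segment, a particle can go from any point of the disk to any open
set of points of the disk with one reflection, and the instant of its arrival can be chosen outside
any finite set. -/
lemma exists_nhds_escapes (hp : p ∈ C.illuminated k) : ∃ U : Set ℂ, IsOpen U ∧ p ∈ U ∧
    ∀ V : Set ℂ, IsOpen V → (V ∩ U ∩ C.rim).Nonempty → (∀ q ∈ V ∩ C.rim, C.Escapes q) →
      ∀ q ∈ U ∩ C.rim, C.Escapes q := by
  obtain ⟨hprim, hev⟩ := hp
  obtain ⟨w, hw⟩ := hev.self_of_nhdsWithin hprim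
  obtain ⟨φ, hφ, d, hd, hc, hpd, hn, hseg⟩ := hw.exists_foot
  have hfeas := eventually_feasible hprim hφ hd hc hpd hn hseg
  rw [nhds_prod_eq] at hfeas
  obtain ⟨Pf, hPf, Pg, hPg, hfeas⟩ := eventually_prod_iff.1 hfeas
  obtain ⟨ε', hε', hPg⟩ := Metric.eventually_nhds_iff.1 hPg
  set ε := min ε' 1 with hε
  have hε0 : 0 < ε := lt_min hε' one_pos
  have hε1 : ε ≤ 1 := min_le_right _ _
  have hfeas : ∀ q, Pf q → ∀ ψ ∈ Ioo (φ - ε) (φ + ε), C.Feasible k (circleMap 0 1 φ) q ψ := by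
    intro q hq ψ hψ
    refine hfeas hq (hPg ?_)
    rw [Real.dist_eq, abs_lt]
    have := min_le_left ε' 1
    exact ⟨by linarith [hψ.1], by linarith [hψ.2]⟩
  set g : ℂ → ℝ := fun q => inner ℝ (q - C.ctr k) (Complex.I * circleMap 0 1 φ) with hg
  have hgc : Continuous g := by fun_prop
  have hgp : g p = 0 := by
    simp only [hg]
    rw [hpd, add_sub_cancel_left, inner_smul_left, inner_eq]
    simp
    ring_nf
    simp
  have hR : 0 < C.rad k + d := add_pos (C.rad_pos k) hd
  -- the sides on which the particles that leave from `p` return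
  have hside : ∀ σ ∈ Ioo (-ε) ε, ∃ a > (0 : ℝ), g (C.retPoint k p (φ + σ)) = a * Real.sin σ := by
    intro σ hσ
    have hf := hfeas p hPf.self_of_nhds (φ + σ) ⟨by linarith [hσ.1], by linarith [hσ.2]⟩
    have hρ := C.rad_pos k
    have hS := Real.sin_sq_add_cos_sq φ
    have hS' := Real.sin_sq_add_cos_sq σ
    have hout : 0 < (C.rad k + d) * Real.cos σ - C.rad k := by
      have := hf.outside
      rw [circleMap_eq (C.ctr k), hpd] at this
      simp only [inner_eq, Complex.sub_re, Complex.sub_im, Complex.add_re, Complex.add_im,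
        Complex.smul_re, Complex.smul_im, smul_eq_mul, unit_re, unit_im, Real.cos_add,
        Real.sin_add] at this
      refine this.trans_eq ?_
      linear_combination ((C.rad k + d) * Real.cos σ - C.rad k) * hS -
        C.rad k * (Real.sin φ ^ 2 + Real.cos φ ^ 2) * hS'
    refine ⟨C.rad k + C.retRatio k p (φ + σ) * (2 * (C.rad k + d) * Real.cos σ - C.rad k), ?_, ?_⟩
    · have := mul_pos hf.ratio_pos
        (by linarith : 0 < 2 * (C.rad k + d) * Real.cos σ - C.rad k)
      linarith
    · have i1 : inner ℝ (circleMap 0 1 (φ + σ)) (Complex.I * circleMap 0 1 φ) = Real.sin σ := by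
        simp only [inner_eq, unit_re, unit_im, Real.cos_add, Real.sin_add, Complex.mul_re,
          Complex.mul_im, Complex.I_re, Complex.I_im]
        linear_combination Real.sin σ * hS
      have i2 : inner ℝ (circleMap 0 1 φ) (Complex.I * circleMap 0 1 φ) = (0 : ℝ) := by
        simp only [inner_eq, unit_re, unit_im, Complex.mul_re, Complex.mul_im, Complex.I_re,
          Complex.I_im]
        ring
      have i3 : inner ℝ (circleMap 0 1 φ) (circleMap 0 1 (φ + σ)) = Real.cos σ := by
        simp only [inner_eq, unit_re, unit_im, Real.cos_add, Real.sin_add]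
        linear_combination Real.cos σ * hS
      have i4 : circleMap (C.ctr k) (C.rad k) (φ + σ) - p =
          C.rad k • circleMap 0 1 (φ + σ) - (C.rad k + d) • circleMap 0 1 φ := by
        rw [circleMap_eq (C.ctr k), hpd]
        abel
      simp only [hg]
      rw [retPoint, reflDir, i4, circleMap_eq (C.ctr k), add_assoc, add_sub_cancel_left]
      simp only [inner_add_left, inner_sub_left, inner_smul_left, i1, i2, i3,
        real_inner_self_eq_norm_sq, norm_unit, conj_trivial]
      ring
  obtain ⟨a, ha, hga⟩ := hside (ε / 2) ⟨by linarith, by linarith⟩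
  obtain ⟨b, hb, hgb⟩ := hside (-(ε / 2)) ⟨by linarith, by linarith⟩
  have hsin : 0 < Real.sin (ε / 2) :=
    Real.sin_pos_of_pos_of_lt_pi (by linarith) (by linarith [Real.pi_gt_three])
  rw [Real.sin_neg] at hgb
  have hga' : 0 < g (C.retPoint k p (φ + ε / 2)) := by rw [hga]; positivity
  have hgb' : g (C.retPoint k p (φ + -(ε / 2))) < 0 := by
    rw [hgb]; exact mul_neg_of_pos_of_neg hb (neg_neg_of_pos hsin)
  obtain ⟨η, hη, hηa, hηb⟩ : ∃ η > 0, η < g (C.retPoint k p (φ + ε / 2)) ∧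
      g (C.retPoint k p (φ + -(ε / 2))) < -η := by
    obtain ⟨η, h1, h2⟩ := exists_between (lt_min hga' (neg_pos.2 hgb'))
    exact ⟨η, h1, h2.trans_le (min_le_left _ _), by linarith [h2.trans_le (min_le_right _ _)]⟩
  have hgret : ∀ q, Pf q → ∀ ψ ∈ Ioo (φ - ε) (φ + ε),
      ContinuousAt (fun x : ℂ × ℝ => g (C.retPoint k x.1 x.2)) (q, ψ) := fun q hq ψ hψ =>
    hgc.continuousAt.comp (f := fun x : ℂ × ℝ => C.retPoint k x.1 x.2)
      (continuousAt_retPoint (hfeas q hq ψ hψ).lead_ne_zero)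
  have hgret1 : ∀ ψ ∈ Ioo (φ - ε) (φ + ε), ContinuousAt (fun q => g (C.retPoint k q ψ)) p :=
    fun ψ hψ => ContinuousAt.comp (f := fun q : ℂ => (q, ψ)) (hgret p hPf.self_of_nhds ψ hψ)
      (by fun_prop)
  have ev1 := (hgret1 (φ + ε / 2) ⟨by linarith, by linarith⟩).eventually (lt_mem_nhds hηa)
  have ev2 := (hgret1 (φ + -(ε / 2)) ⟨by linarith, by linarith⟩).eventually (gt_mem_nhds hηb)
  have ev3 : ∀ᶠ q in 𝓝 p, g q ∈ Ioo (-η) η := by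
    refine hgc.continuousAt.eventually (Ioo_mem_nhds ?_ ?_) <;> rw [hgp] <;> linarith
  have ev4 : ∀ᶠ q in 𝓝 p, inner ℝ (q - C.c) (circleMap 0 1 φ) < (0 : ℝ) := by
    refine (by fun_prop : Continuous fun q : ℂ =>
      inner ℝ (q - C.c) (circleMap 0 1 φ)).continuousAt.eventually (gt_mem_nhds ?_)
    change inner ℝ (p - C.c) (circleMap 0 1 φ) < (0 : ℝ)
    rwa [real_inner_comm]
  obtain ⟨U, hU, hUo, hpU⟩ := eventually_nhds_iff.1 (hPf.and (ev1.and (ev2.and (ev3.and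
    (ev4.and (eventually_exists_foot hR hpd hε0))))))
  refine ⟨U, hUo, hpU, ?_⟩
  rintro V hV ⟨y, ⟨hyV, hyU⟩, hyr⟩ hesc q ⟨hqU, hqr⟩ u hu s F
  obtain ⟨hq, hq1, hq2, -, -, ψ₁, hψ₁, R, hqR⟩ := hU q hqU
  obtain ⟨-, -, -, hy3, hy4, -⟩ := hU y hyU
  have hgretq : ∀ ψ ∈ Ioo (φ - ε) (φ + ε), ContinuousAt (fun ψ => C.retPoint k q ψ) ψ :=
    fun ψ hψ => ContinuousAt.comp (f := fun ψ : ℝ => (q, ψ))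
      (g := fun x : ℂ × ℝ => C.retPoint k x.1 x.2)
      (continuousAt_retPoint (hfeas q hq ψ hψ).lead_ne_zero) (by fun_prop)
  -- the reflection that leads from `q` to `y`
  obtain ⟨ψ, hψ, hψy⟩ : ∃ ψ ∈ Ioo (φ - ε) (φ + ε), C.retPoint k q ψ = y := by
    have hsub : Icc (φ + -(ε / 2)) (φ + ε / 2) ⊆ Ioo (φ - ε) (φ + ε) := fun x hx =>
      ⟨by linarith [hx.1], by linarith [hx.2]⟩
    have hco : ContinuousOn (fun ψ => g (C.retPoint k q ψ)) (Icc (φ + -(ε / 2)) (φ + ε / 2)) :=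
      fun x hx => (hgc.continuousAt.comp (hgretq x (hsub hx))).continuousWithinAt
    obtain ⟨ψ, hψ, hgψ⟩ := intermediate_value_Icc (by linarith) hco
      (show g y ∈ Icc _ _ from ⟨(hq2.trans hy3.1).le, (hy3.2.trans hq1).le⟩)
    have hf := hfeas q hq ψ (hsub hψ)
    exact ⟨ψ, hsub hψ, eq_of_mem_rim_of_inner_eq hf.retPoint_mem_rim hyr hf.ret_side hy4 hgψ⟩
  set τ : ℝ → ℝ := fun ψ =>
    s + (C.normalDist k q ψ / u + C.retRatio k q ψ * (C.normalDist k q ψ / u)) with hτ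
  have hanal : AnalyticOnNhd ℝ τ (Ioo (φ - ε) (φ + ε)) := by
    intro x hx
    have hf := hfeas q hq x hx
    have h1 : AnalyticAt ℝ (fun x => C.normalDist k q x / u) x :=
      analyticAt_normalDist.div analyticAt_const hu.ne'
    exact analyticAt_const.add
      (h1.add ((analyticAt_retRatio hf.lead_ne_zero hf.disc_pos).mul h1))
  -- the instant of return is not constant
  have hne : ∀ f : ℝ, ¬ ∀ᶠ x in 𝓝 ψ, τ x = f := by
    intro f hf
    have heq := hanal.eqOn_of_preconnected_of_eventuallyEq (g := fun _ => f)
      (fun _ _ => analyticAt_const) isPreconnected_Ioo hψ hf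
    have hf₁ := hfeas q hq ψ₁ hψ₁
    have hqz : q - circleMap (C.ctr k) (C.rad k) ψ₁ = (R - C.rad k) • circleMap 0 1 ψ₁ := by
      rw [circleMap_eq (C.ctr k), hqR, sub_smul]
      abel
    have hRρ : C.rad k < R := by
      have := hf₁.outside
      rw [hqz, inner_smul_left, real_inner_self_eq_norm_sq, norm_unit, conj_trivial] at this
      linarith
    have hneg : inner ℝ (circleMap 0 1 ψ₁) (q - C.c) < (0 : ℝ) := by
      have := hf₁.leaves
      rw [← neg_sub, hqz, inner_neg_left, inner_smul_left, conj_trivial, neg_pos] at this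
      by_contra! h
      exact absurd this (not_lt.2 (mul_nonneg (sub_pos.2 hRρ).le h))
    obtain ⟨x, hx, hne⟩ := exists_time_ne hqr hqR hRρ hneg
      (lt_min (sub_pos.2 hψ₁.1) (sub_pos.2 hψ₁.2))
    have hx' : x ∈ Ioo (φ - ε) (φ + ε) := by
      have h1 := min_le_left (ψ₁ - (φ - ε)) (φ + ε - ψ₁)
      have h2 := min_le_right (ψ₁ - (φ - ε)) (φ + ε - ψ₁)
      exact ⟨by linarith [hx.1], by linarith [hx.2]⟩
    have h1 : τ x = τ ψ₁ := (heq hx').trans (heq hψ₁).symm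
    refine hne ?_
    simp only [hτ] at h1
    field_simp at h1
    linarith
  have hev1 : ∀ᶠ x in 𝓝[≠] ψ, ∀ f ∈ F, τ x ≠ f := by
    rw [Filter.eventually_all_finset]
    intro f _
    exact ((hanal ψ hψ).eventually_eq_or_eventually_ne analyticAt_const).resolve_left (hne f)
  have hev2 : ∀ᶠ x in 𝓝[≠] ψ, x ∈ Ioo (φ - ε) (φ + ε) ∧ C.retPoint k q x ∈ V :=
    nhdsWithin_le_nhds (Filter.Eventually.and (Ioo_mem_nhds hψ.1 hψ.2)
      ((hgretq ψ hψ).eventually (hV.mem_nhds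
        (show C.retPoint k q ψ ∈ V from hψy.symm ▸ hyV))))
  obtain ⟨x, hxF, hx, hxV⟩ := (hev1.and hev2).exists
  have hf := hfeas q hq x hx
  exact hf.escape hqr (hesc _ ⟨hxV, hf.retPoint_mem_rim⟩) hu s F fun h => hxF _ h rfl

end ScattererCell

namespace ScattererCell

variable {C : ScattererCell} {k : Fin C.b} {p : ℂ}

/-! ### Flights through the right opening -/

/-- The segment from a point `p` of the disk to a point `q` of the right opening is unobstructed if
`p` is seen from the center of the disk within the angle subtended by the opening. -/
lemma openSegment_exit {q : ℂ} (hp : p ∈ C.rim) (hpre : C.L / 2 < p.re)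
    (hpim : |p.im| ≤ (p.re - C.L / 2) / (C.L / 2) * C.a) (hqre : q.re = C.L) (hqim : |q.im| ≤ C.a)
    (hout : 0 < inner ℝ (q - p) (p - C.c)) : openSegment ℝ p q ⊆ C.region \ C.bdry := by
  have hL := C.r_pos.trans half_width
  have hp1 : p.re - C.L / 2 ≤ C.r := by
    have h := Complex.re_le_norm (p - C.c)
    rwa [norm_sub_c_of_mem_rim hp, Complex.sub_re, c_re] at h
  rw [openSegment_eq_image']
  rintro _ ⟨s, hs, rfl⟩
  simp only
  rw [mem_region_diff_bdry_iff]
  refine ⟨?_, not_mem_closedBall_of_outward hp hout hs.1⟩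
  set l := (p.re - C.L / 2) / (C.L / 2) with hl
  have hl0 : 0 < l := div_pos (sub_pos.2 hpre) hL
  have hl1 : l < 1 := by
    rw [hl, div_lt_one hL]
    exact hp1.trans_lt half_width
  have hlL : l * (C.L / 2) = p.re - C.L / 2 := div_mul_cancel₀ _ hL.ne'
  have hs1 : 0 < 1 - s := sub_pos.2 hs.2
  refine mem_interior_of_cone (l := (1 - s) * l + s) ?_ ?_ ?_ ?_
  · have := mul_pos hs1 hl0
    linarith [hs.1]
  · nlinarith
  · rw [Complex.add_re, Complex.smul_re, Complex.sub_re, smul_eq_mul, hqre]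
    linear_combination (1 - s) * (-hlL)
  · have him : (p + s • (q - p)).im = (1 - s) * p.im + s * q.im := by
      rw [Complex.add_im, Complex.smul_im, Complex.sub_im, smul_eq_mul]
      ring
    rw [him]
    calc |(1 - s) * p.im + s * q.im| ≤ |(1 - s) * p.im| + |s * q.im| := abs_add_le _ _
      _ = (1 - s) * |p.im| + s * |q.im| := by
        rw [abs_mul, abs_mul, abs_of_pos hs1, abs_of_pos hs.1]
      _ ≤ (1 - s) * (l * C.a) + s * C.a :=
        add_le_add (mul_le_mul_of_nonneg_left hpim hs1.le) (mul_le_mul_of_nonneg_left hqim hs.1.le)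
      _ = ((1 - s) * l + s) * C.a := by ring

lemma mem_openings_right {q : ℂ} (hqre : q.re = C.L) (hqim : |q.im| ≤ C.a) : q ∈ C.openings :=
  Or.inr ⟨hqre, hqim⟩

/-- A straight flight from the disk through the right opening. -/
lemma tour_exit {q v : ℂ} {s e : ℝ} (hse : s < e) (hp : p ∈ C.rim) (hqre : q.re = C.L)
    (hqim : |q.im| < C.a) (hq : q = p + (e - s) • v)
    (hseg : openSegment ℝ p q ⊆ C.region \ C.bdry) : C.Tour (Track.straight p v s) s e ∅ where
  lt := hse
  moves := moves_straight hq (rim_subset_region hp) (rim_not_corner hp)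
    (frontier_subset_region (openings_subset_frontier (mem_openings_right hqre hqim.le)))
    (not_corner_of_lt hqre hqim) hseg (by simp)
  exits := by
    have : (Track.straight p v s).pos e = q := hq.symm
    rw [this]
    exact mem_openings_right hqre hqim.le
  hits t := ⟨fun h => absurd h (Finset.notMem_empty t), fun h =>
    absurd (Or.inr h.2) (straight_mem hq hseg (by simp) t h.1).2⟩
  bounces t h := absurd h (Finset.notMem_empty t)

/-- The point of the disk closest to the right opening. -/
noncomputable def eastPoint (C : ScattererCell) : ℂ := C.c + (C.r : ℂ)

lemma eastPoint_mem_rim : C.eastPoint ∈ C.rim := by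
  simp [rim, eastPoint, abs_of_pos C.r_pos]

lemma eastPoint_re : C.eastPoint.re = C.L / 2 + C.r := by simp [eastPoint, c_re]

lemma eastPoint_im : C.eastPoint.im = 0 := by simp [eastPoint, c_im]

lemma en_eastPoint : C.en C.eastPoint = 1 := by
  have := C.r_pos.ne'
  rw [en, eastPoint, add_sub_cancel_left, Complex.real_smul, ← Complex.ofReal_mul,
    inv_mul_cancel₀ this, Complex.ofReal_one]

/-- Near the right opening a particle can leave the disk in the horizontal direction. -/
lemma exists_nhds_eastPoint : ∃ U : Set ℂ, IsOpen U ∧ C.eastPoint ∈ U ∧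
    ∀ p ∈ U ∩ C.rim, C.Escapes p := by
  have hL := C.r_pos.trans half_width
  refine ⟨{p | C.L / 2 < p.re ∧ |p.im| < (p.re - C.L / 2) / (C.L / 2) * C.a}, ?_, ?_, ?_⟩
  · exact (isOpen_lt continuous_const Complex.continuous_re).inter
      (isOpen_lt Complex.continuous_im.abs
        (((Complex.continuous_re.sub continuous_const).div_const _).mul continuous_const))
  · have h1 := C.r_pos
    have h2 := C.a_pos
    simp only [mem_ofPred_eq, eastPoint_re, eastPoint_im, abs_zero, add_sub_cancel_left]
    exact ⟨by linarith, by positivity⟩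
  rintro p ⟨⟨hre, him⟩, hp⟩ u hu s F
  have hp1 : p.re - C.L / 2 ≤ C.r := by
    have h := Complex.re_le_norm (p - C.c)
    rwa [norm_sub_c_of_mem_rim hp, Complex.sub_re, c_re] at h
  have hpL : p.re < C.L := by linarith [half_width (C := C)]
  have hima : |p.im| < C.a := by
    refine him.trans ?_
    have : (p.re - C.L / 2) / (C.L / 2) < 1 := by
      rw [div_lt_one hL]
      linarith
    exact mul_lt_of_lt_one_left C.a_pos this
  set κ := C.r⁻¹ * (p.re - C.L / 2) with hκ
  have hκ0 : 0 < κ := mul_pos (inv_pos.2 C.r_pos) (sub_pos.2 hre)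
  set q : ℂ := ⟨C.L, p.im⟩ with hq
  have hd : 0 < C.L - p.re := sub_pos.2 hpL
  set e := s + (C.L - p.re) / (u / κ) with he
  have hse : s < e := by
    rw [he]
    have : 0 < (C.L - p.re) / (u / κ) := by positivity
    linarith
  have hpq : q - p = ((C.L - p.re : ℝ) : ℂ) := by
    apply Complex.ext <;> simp [hq]
  refine ⟨Track.straight p ((u / κ : ℝ) : ℂ) s, e, ∅, tour_exit hse hp (q := q) rfl hima ?_ ?_, ?_,
    ?_, Finset.disjoint_empty_left _⟩
  · have huk : u / κ ≠ 0 := (div_pos hu hκ0).ne'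
    rw [← sub_eq_iff_eq_add', hpq, he, add_sub_cancel_left, Complex.real_smul,
      ← Complex.ofReal_mul, div_mul_cancel₀ _ huk]
  · refine openSegment_exit hp hre him.le rfl hima.le ?_
    rw [hpq, inner_eq]
    simpa [c_re] using mul_pos hd (sub_pos.2 hre)
  · simp [Track.straight]
  · change inner ℝ ((u / κ : ℝ) : ℂ) (C.en p) = u
    have h : inner ℝ ((u / κ : ℝ) : ℂ) (p - C.c) = u / κ * (p.re - C.L / 2) := by
      rw [inner_eq, Complex.ofReal_re, Complex.ofReal_im, Complex.sub_re, c_re, zero_mul, add_zero]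
    rw [inner_en, h, mul_left_comm, ← hκ, div_mul_cancel₀ _ hκ0.ne']

/-! ### Escape from the disk -/

/-- In a controllable cell a particle can escape from every point of the disk: the relative interior
of the set of the points from which it can escape is not empty, and by local controllability it is
closed in the disk boundary, which is connected. -/
lemma OneControllable.escapes (hC : C.OneControllable) (hp : p ∈ C.rim) : C.Escapes p := by
  set W : Set ℂ := {q | ∃ U : Set ℂ, IsOpen U ∧ q ∈ U ∧ ∀ y ∈ U ∩ C.rim, C.Escapes y} with hW
  have hWo : IsOpen W := by
    rw [isOpen_iff_mem_nhds]
    rintro q ⟨U, hU, hqU, h⟩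
    exact Filter.mem_of_superset (hU.mem_nhds hqU) fun y hy => ⟨U, hU, hy, h⟩
  set Z : Set ℂ := {q | ∃ U : Set ℂ, IsOpen U ∧ q ∈ U ∧ U ∩ C.rim ∩ W = ∅} with hZ
  have hZo : IsOpen Z := by
    rw [isOpen_iff_mem_nhds]
    rintro q ⟨U, hU, hqU, h⟩
    exact Filter.mem_of_superset (hU.mem_nhds hqU) fun y hy => ⟨U, hU, hy, h⟩
  have hcover : C.rim ⊆ W ∪ Z := by
    intro q hq
    rw [← show ⋃ k, C.illuminated k = C.rim from hC, mem_iUnion] at hq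
    obtain ⟨k, hk⟩ := hq
    obtain ⟨U, hU, hqU, h⟩ := exists_nhds_escapes hk
    rcases (U ∩ C.rim ∩ W).eq_empty_or_nonempty with h0 | ⟨y, ⟨hyU, hyr⟩, V, hV, hyV, hesc⟩
    · exact Or.inr ⟨U, hU, hqU, h0⟩
    · exact Or.inl ⟨U, hU, hqU, h V hV ⟨y, ⟨hyV, hyU⟩, hyr⟩ hesc⟩
  have hdisj : C.rim ∩ (W ∩ Z) = ∅ := by
    ext q
    refine ⟨?_, fun h => absurd h (notMem_empty q)⟩
    rintro ⟨hq, hqW, U, -, hqU, h⟩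
    rw [← h]
    exact ⟨⟨hqU, hq⟩, hqW⟩
  have hpre : IsPreconnected C.rim :=
    isPreconnected_sphere (by rw [Complex.rank_real_complex]; exact Cardinal.one_lt_two) _ _
  have hE : C.eastPoint ∈ C.rim ∩ W := ⟨eastPoint_mem_rim, exists_nhds_eastPoint⟩
  rcases isPreconnected_iff_subset_of_disjoint.1 hpre W Z hWo hZo hcover hdisj with h | h
  · obtain ⟨U, -, hpU, hU⟩ := h hp
    exact hU p ⟨hpU, hp⟩
  · have : C.eastPoint ∈ C.rim ∩ (W ∩ Z) := ⟨hE.1, hE.2, h hE.1⟩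
    rw [hdisj] at this
    exact absurd this (notMem_empty _)

/-! ### Drivers -/

/-- A fast particle (driver) can be sent through the right opening to the disk, in an arbitrarily
short time around a given instant `s`, with a tangential velocity `w'` that becomes the angular
velocity of the disk; whatever the angular velocity `w` of the disk before the collision, the driver
leaves through the same opening if it is fast enough. -/
lemma exists_driver (C : ScattererCell) (s w w' : ℝ) {η : ℝ} (hη : 0 < η) :
    ∃ (x : Track) (δ : ℝ), 0 < δ ∧ δ < η ∧ C.Tour x (s - δ) (s + δ) {s} ∧
      x.pos (s - δ) ∈ opening C.L C.a ∧ (x.vOut (s - δ)).re < 0 ∧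
      inner ℝ (x.vOut s) (C.et (x.pos s)) = w ∧
      inner ℝ (x.vIn s) (C.et (x.pos s)) = w' := by
  have hd : 0 < C.L / 2 - C.r := sub_pos.2 half_width
  obtain ⟨δ, hδ0, hδη, hδw, hδw'⟩ : ∃ δ > 0, δ < η ∧ δ * |w| < C.a ∧ δ * |w'| < C.a := by
    have h1 : ∀ x : ℝ, ∀ᶠ δ in 𝓝[>] (0 : ℝ), δ * |x| < C.a := by
      intro x
      refine nhdsWithin_le_nhds ((by fun_prop : Continuous fun δ : ℝ =>
        δ * |x|).continuousAt.eventually (gt_mem_nhds ?_))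
      simpa using C.a_pos
    obtain ⟨δ, ⟨h, h'⟩, h0, hη'⟩ := (((h1 w).and (h1 w')).and (Ioo_mem_nhdsGT hη)).exists
    exact ⟨δ, h0, hη', h, h'⟩
  set V := (C.L / 2 - C.r) / δ with hV
  have hV0 : 0 < V := div_pos hd hδ0
  have hδV : δ * V = C.L / 2 - C.r := mul_div_cancel₀ _ hδ0.ne'
  have hseg : ∀ q : ℂ, q.re = C.L → |q.im| ≤ C.a →
      openSegment ℝ C.eastPoint q ⊆ C.region \ C.bdry := by
    intro q h1 h2
    refine openSegment_exit eastPoint_mem_rim ?_ ?_ h1 h2 ?_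
    · rw [eastPoint_re]; linarith [C.r_pos]
    · have := C.r_pos
      have := C.a_pos
      have := C.r_pos.trans half_width
      rw [eastPoint_im, eastPoint_re, add_sub_cancel_left, abs_zero]
      positivity
    · rw [inner_eq]
      simp only [Complex.sub_re, Complex.sub_im, eastPoint_re, eastPoint_im, h1, c_re, c_im]
      nlinarith [mul_pos hd C.r_pos]
  set vi : ℂ := ⟨-V, -w'⟩ with hvi
  set vo : ℂ := ⟨V, -w⟩ with hvo
  have hi : (C.eastPoint + ((s - δ) - s) • vi).re = C.L ∧
      |(C.eastPoint + ((s - δ) - s) • vi).im| < C.a := by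
    rw [Complex.add_re, Complex.add_im, Complex.smul_re, Complex.smul_im, eastPoint_re, eastPoint_im]
    simp only [hvi, smul_eq_mul]
    constructor
    · linear_combination hδV
    · rwa [show 0 + (s - δ - s) * -w' = δ * w' by ring, abs_mul, abs_of_pos hδ0]
  have ho : (C.eastPoint + ((s + δ) - s) • vo).re = C.L ∧
      |(C.eastPoint + ((s + δ) - s) • vo).im| < C.a := by
    rw [Complex.add_re, Complex.add_im, Complex.smul_re, Complex.smul_im, eastPoint_re, eastPoint_im]
    simp only [hvo, smul_eq_mul]
    constructor
    · linear_combination hδV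
    · rwa [show 0 + (s + δ - s) * -w = -(δ * w) by ring, abs_neg, abs_mul, abs_of_pos hδ0]
  have hout := tour_exit (by linarith : s < s + δ) C.eastPoint_mem_rim ho.1 ho.2 rfl
    (hseg _ ho.1 ho.2.le)
  have hsegi := hseg _ hi.1 hi.2.le
  rw [openSegment_symm] at hsegi
  have hqi : C.eastPoint = C.eastPoint + ((s - δ) - s) • vi + (s - (s - δ)) • vi := by
    rw [add_assoc, ← add_smul]
    simp
  have hin : C.Moves (Track.straight C.eastPoint vi s) (s - δ) s :=
    moves_straight hqi (frontier_subset_region (openings_subset_frontier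
      (mem_openings_right hi.1 hi.2.le))) (not_corner_of_lt hi.1 hi.2)
      (rim_subset_region eastPoint_mem_rim) (rim_not_corner eastPoint_mem_rim) hsegi rfl
  have hps : (Track.straight C.eastPoint vi s).pos s = C.eastPoint := by simp [Track.straight]
  have hlt : s - δ < s := by linarith
  refine ⟨(Track.straight C.eastPoint vi s).glue (Track.straight C.eastPoint vo s) s, δ, hδ0, hδη,
    ?_, ?_, ?_, ?_, ?_⟩
  · have h1 : inner ℝ vi (1 : ℂ) = -V := by simp [hvi]
    have h2 : inner ℝ vo (1 : ℂ) = V := by simp [hvo]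
    refine hout.glue hin hlt ?_ ?_ ?_ ?_ ?_ ?_ ?_
    · exact fun t ht h => (straight_mem hqi hsegi rfl t ht).2 (Or.inr h)
    · rw [hps]; simp [Track.straight]
    · rw [hps]; exact eastPoint_mem_rim
    · rw [hps]; exact rim_not_opening eastPoint_mem_rim
    · rw [hps]; exact rim_not_arc eastPoint_mem_rim
    · rw [hps, en_eastPoint]
      change inner ℝ vi (1 : ℂ) ≠ 0
      rw [h1]
      linarith
    · rw [hps, en_eastPoint]
      change inner ℝ vo (1 : ℂ) = -inner ℝ vi (1 : ℂ)
      rw [h1, h2, neg_neg]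
  · rw [Track.glue_pos_of_le hlt.le]
    exact ⟨hi.1, hi.2.le⟩
  · rw [Track.glue_vOut_of_lt hlt]
    change -V < 0
    linarith
  · rw [Track.glue_pos_of_le le_rfl, Track.glue_vOut_of_ge le_rfl, hps, et, en_eastPoint]
    change inner ℝ vo (-Complex.I * 1) = w
    simp [hvo]
  · rw [Track.glue_pos_of_le le_rfl, Track.glue_vIn_of_le le_rfl, hps, et, en_eastPoint]
    change inner ℝ vi (-Complex.I * 1) = w'
    simp [hvi]

end ScattererCell

/-! ### The disk -/

/-- The disk can be given prescribed angular velocities from prescribed instants on. -/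
lemma DiskTrack.exists_jumps (a₀ : Real.Angle) (w₀ : ℝ) (A : Finset ℝ) (hA : ∀ t ∈ A, 0 < t)
    (val : ℝ → ℝ) : ∃ d : DiskTrack, (∀ T, d.Rotates T) ∧ d.ang 0 = a₀ ∧ d.wOut 0 = w₀ ∧
      (∀ t ∈ A, d.wOut t = val t) ∧ (∀ t ∉ A, d.wOut t = d.wIn t) ∧
      ∀ s t, s < t → (∀ a ∈ A, a ∉ Ioo s t) → d.wIn t = d.wOut s := by
  obtain ⟨J, hJ⟩ : ∃ J : ℝ → ℝ, ∀ t ∈ A, w₀ + ∑ e ∈ A, (if e ≤ t then J e else 0) = val t := by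
    clear hA
    induction A using Finset.induction_on_max with
    | empty => exact ⟨0, fun t ht => absurd ht (Finset.notMem_empty t)⟩
    | insert a A hmax ih =>
      obtain ⟨J, hJ⟩ := ih
      have haA : a ∉ A := fun h => lt_irrefl a (hmax a h)
      have hsum : ∀ t, ∑ e ∈ A, (if e ≤ t then
          Function.update J a (val a - (w₀ + ∑ e ∈ A, J e)) e else 0) =
          ∑ e ∈ A, if e ≤ t then J e else 0 := fun t =>
        Finset.sum_congr rfl fun e he => by
          rw [Function.update_of_ne (hmax e he).ne]
      refine ⟨Function.update J a (val a - (w₀ + ∑ e ∈ A, J e)), fun t ht => ?_⟩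
      rw [Finset.sum_insert haA, hsum]
      rcases Finset.mem_insert.1 ht with rfl | ht
      · rw [if_pos le_rfl, Function.update_self,
          Finset.sum_congr rfl fun e he => if_pos (hmax e he).le]
        ring
      · rw [if_neg (not_le.2 (hmax t ht)), zero_add, hJ t ht]
  refine ⟨{ ang := fun t => a₀ + ((w₀ * t + ∑ e ∈ A, J e * max (t - e) 0 : ℝ) : Real.Angle)
            wIn := fun t => w₀ + ∑ e ∈ A, if e < t then J e else 0
            wOut := fun t => w₀ + ∑ e ∈ A, if e ≤ t then J e else 0 }, fun T => ⟨?_, ?_⟩, ?_, ?_, hJ,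
            ?_, ?_⟩
  · intro t _
    have hev : ∀ᶠ u in 𝓝[>] t, ∀ e ∈ A, e ≤ t ∨ u < e := by
      rw [Filter.eventually_all_finset]
      intro e _
      rcases le_or_gt e t with h | h
      · exact Eventually.of_forall fun _ => Or.inl h
      · filter_upwards [Ioo_mem_nhdsGT h] with u hu using Or.inr hu.2
    filter_upwards [hev, self_mem_nhdsWithin] with u hu htu
    have htu : t < u := htu
    refine ⟨?_, ?_, ?_⟩
    · rw [add_assoc, ← Real.Angle.coe_add]
      congr 2
      have : ∑ e ∈ A, J e * max (u - e) 0 = ∑ e ∈ A, J e * max (t - e) 0 +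
          (∑ e ∈ A, if e ≤ t then J e else 0) * (u - t) := by
        rw [Finset.sum_mul, ← Finset.sum_add_distrib]
        refine Finset.sum_congr rfl fun e he => ?_
        rcases le_or_gt e t with h | h
        · rw [if_pos h, max_eq_left (by linarith), max_eq_left (by linarith)]
          ring
        · have := (hu e he).resolve_left (not_le.2 h)
          rw [if_neg (not_le.2 h), max_eq_right (by linarith), max_eq_right (by linarith)]
          ring
      rw [this]
      ring
    · refine congrArg (w₀ + ·) (Finset.sum_congr rfl fun e he => ?_)
      rcases hu e he with h | h
      · rw [if_pos h, if_pos (h.trans_lt htu)]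
      · rw [if_neg (not_lt.2 h.le), if_neg (not_le.2 (htu.trans h))]
    · refine congrArg (w₀ + ·) (Finset.sum_congr rfl fun e he => ?_)
      rcases hu e he with h | h
      · rw [if_pos h, if_pos (h.trans htu.le)]
      · rw [if_neg (not_le.2 h), if_neg (not_le.2 (htu.trans h))]
  · intro t _
    have hev : ∀ᶠ u in 𝓝[<] t, ∀ e ∈ A, t ≤ e ∨ e < u := by
      rw [Filter.eventually_all_finset]
      intro e _
      rcases le_or_gt t e with h | h
      · exact Eventually.of_forall fun _ => Or.inl h
      · filter_upwards [Ioo_mem_nhdsLT h] with u hu using Or.inr hu.1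
    filter_upwards [hev, self_mem_nhdsWithin] with u hu hut
    have hut : u < t := hut
    refine ⟨?_, ?_, ?_⟩
    · rw [add_assoc, ← Real.Angle.coe_add]
      congr 2
      have : ∑ e ∈ A, J e * max (u - e) 0 = ∑ e ∈ A, J e * max (t - e) 0 +
          (∑ e ∈ A, if e < t then J e else 0) * (u - t) := by
        rw [Finset.sum_mul, ← Finset.sum_add_distrib]
        refine Finset.sum_congr rfl fun e he => ?_
        rcases hu e he with h | h
        · rw [if_neg (not_lt.2 h), max_eq_right (by linarith), max_eq_right (by linarith)]
          ring
        · rw [if_pos (h.trans hut), max_eq_left (by linarith), max_eq_left (by linarith)]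
          ring
      rw [this]
      ring
    · refine congrArg (w₀ + ·) (Finset.sum_congr rfl fun e he => ?_)
      rcases hu e he with h | h
      · rw [if_neg (not_lt.2 (hut.le.trans h)), if_neg (not_lt.2 h)]
      · rw [if_pos h, if_pos (h.trans hut)]
    · refine congrArg (w₀ + ·) (Finset.sum_congr rfl fun e he => ?_)
      rcases hu e he with h | h
      · rw [if_neg (not_le.2 (hut.trans_le h)), if_neg (not_lt.2 h)]
      · rw [if_pos h.le, if_pos (h.trans hut)]
  · have : ∑ e ∈ A, J e * max (0 - e) 0 = 0 := Finset.sum_eq_zero fun e he => by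
      rw [max_eq_right (by linarith [hA e he]), mul_zero]
    simp only
    rw [this, mul_zero, add_zero, Real.Angle.coe_zero, add_zero]
  · have : ∑ e ∈ A, (if e ≤ 0 then J e else 0) = 0 := Finset.sum_eq_zero fun e he =>
      if_neg (not_le.2 (hA e he))
    simp only
    rw [this, add_zero]
  · intro t ht
    refine congrArg (w₀ + ·) (Finset.sum_congr rfl fun e he => ?_)
    have hne : e ≠ t := fun h => ht (h ▸ he)
    rcases hne.lt_or_gt with h | h
    · rw [if_pos h, if_pos h.le]
    · rw [if_neg (not_lt.2 h.le), if_neg (not_le.2 h)]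
  · intro s t hst hno
    refine congrArg (w₀ + ·) (Finset.sum_congr rfl fun e he => ?_)
    rcases le_or_gt e s with h | h
    · rw [if_pos h, if_pos (h.trans_lt hst)]
    · rw [if_neg (not_le.2 h), if_neg fun h' => hno e he ⟨h, h'⟩]

namespace ScattererCell

variable {C : ScattererCell}

/-! ### Tours of the tracers and the orbit -/

lemma eq_en_add_et {p : ℂ} (hp : p ∈ C.rim) (v : ℂ) :
    v = (inner ℝ v (C.en p) : ℝ) • C.en p + (inner ℝ v (C.et p) : ℝ) • C.et p := by
  have h1 : ‖C.en p‖ ^ 2 = 1 := by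
    rw [en, norm_smul, norm_sub_c_of_mem_rim hp, norm_inv, Real.norm_of_nonneg C.r_pos.le,
      inv_mul_cancel₀ C.r_pos.ne', one_pow]
  rw [norm_sq_eq] at h1
  simp only [inner_eq, et]
  apply Complex.ext
  · simp
    linear_combination (-v.re) * h1
  · simp
    linear_combination (-v.im) * h1

/-- Choice of one object for each index, such that finite sets attached to them are disjoint. -/
lemma exists_disjoint_family {ι α : Type*} [Finite ι] (P : ι → α → Prop) (K : ι → α → Finset ℝ)
    (h : ∀ i F, ∃ a, P i a ∧ Disjoint (K i a) F) (F₀ : Finset ℝ) :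
    ∃ a : ι → α, (∀ i, P i (a i) ∧ Disjoint (K i (a i)) F₀) ∧
      ∀ i j, i ≠ j → Disjoint (K i (a i)) (K j (a j)) := by
  classical
  have := Fintype.ofFinite ι
  have key : ∀ S : Finset ι, ∃ a : ι → α, ∀ i ∈ S, (P i (a i) ∧ Disjoint (K i (a i)) F₀) ∧
      ∀ j ∈ S, i ≠ j → Disjoint (K i (a i)) (K j (a j)) := by
    intro S
    induction S using Finset.induction_on with
    | empty =>
      choose a _ using fun i => h i ∅
      exact ⟨a, fun i hi => absurd hi (Finset.notMem_empty i)⟩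
    | insert k S hk ih =>
      obtain ⟨a, ha⟩ := ih
      obtain ⟨b, hb, hbF⟩ := h k (F₀ ∪ S.biUnion fun j => K j (a j))
      rw [Finset.disjoint_union_right, Finset.disjoint_biUnion_right] at hbF
      have hu : ∀ i ∈ S, Function.update a k b i = a i := fun i hi =>
        Function.update_of_ne (fun h : i = k => hk (h ▸ hi)) _ _
      refine ⟨Function.update a k b, fun i hi => ⟨?_, fun j hj hij => ?_⟩⟩
      · rcases Finset.mem_insert.1 hi with rfl | hi
        · rw [Function.update_self]
          exact ⟨hb, hbF.1⟩
        · rw [hu i hi]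
          exact (ha i hi).1
      · rcases Finset.mem_insert.1 hi with rfl | hi' <;>
          rcases Finset.mem_insert.1 hj with rfl | hj'
        · exact absurd rfl hij
        · rw [Function.update_self, hu j hj']
          exact hbF.2 j hj'
        · rw [Function.update_self, hu i hi']
          exact (hbF.2 i hi').symm
        · rw [hu i hi', hu j hj']
          exact (ha i hi').2 j hj' hij
  obtain ⟨a, ha⟩ := key Finset.univ
  exact ⟨a, fun i => (ha i (Finset.mem_univ i)).1,
    fun i j hij => (ha i (Finset.mem_univ i)).2 j (Finset.mem_univ j) hij⟩

/-- A particle that reaches the disk, not tangentially, comes from outside. -/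
lemma Moves.inner_vIn_neg {x : Track} {s e : ℝ} (hx : C.Moves x s e) (hse : s < e)
    (hr : x.pos e ∈ C.rim) (h : inner ℝ (x.vIn e) (C.en (x.pos e)) ≠ (0 : ℝ)) :
    inner ℝ (x.vIn e) (C.en (x.pos e)) < (0 : ℝ) := by
  refine lt_of_le_of_ne ?_ h
  by_contra! hpos
  rw [inner_en] at hpos
  have hpos' : 0 < inner ℝ (x.vIn e) (x.pos e - C.c) := by
    rwa [mul_pos_iff_of_pos_left (inv_pos.2 C.r_pos)] at hpos
  have hev : ∀ᶠ u in 𝓝[<] e, 0 <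
      2 * inner ℝ (x.vIn e) (x.pos e - C.c) + (u - e) * ‖x.vIn e‖ ^ 2 := by
    refine nhdsWithin_le_nhds ((by fun_prop : Continuous fun u : ℝ =>
      2 * inner ℝ (x.vIn e) (x.pos e - C.c) +
        (u - e) * ‖x.vIn e‖ ^ 2).continuousAt.eventually (lt_mem_nhds ?_))
    simpa using hpos'
  obtain ⟨u, ⟨hu1, hu2⟩, hu3⟩ :=
    ((hev.and (hx.flies.2 e ⟨hse, le_rfl⟩)).and (Ioo_mem_nhdsLT hse)).exists
  have h1 := (hx.mem_region u ⟨hu3.1.le, hu3.2.le⟩).2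
  rw [mem_ball_iff_norm, not_lt, hu2.1, ← sq_le_sq₀ C.r_pos.le (norm_nonneg _), add_sub_right_comm,
    norm_add_sq_real, norm_sub_c_of_mem_rim hr, inner_smul_right, norm_smul, mul_pow,
    Real.norm_eq_abs, sq_abs, real_inner_comm] at h1
  nlinarith [mul_pos (sub_pos.2 hu3.2) hu1]

/-- The motion of a tracer up to its first arrival on the disk or on an opening can be prolonged to
a tour whose later collisions avoid a given finite set of instants. -/
lemma OneControllable.exists_tour (hC : C.OneControllable) {x : Track} {τ : ℝ} (hτ : 0 < τ)
    (hx : C.Moves x 0 τ) (hend : x.pos τ ∈ C.rim ∪ C.openings)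
    (hno : ∀ t ∈ Ioo 0 τ, x.pos t ∉ C.rim ∪ C.openings)
    (hv : x.pos τ ∈ C.rim → inner ℝ (x.vIn τ) (C.en (x.pos τ)) ≠ (0 : ℝ)) (F : Finset ℝ) :
    ∃ (y : Track) (d : ℝ) (K : Finset ℝ), C.Tour y 0 d K ∧ y.pos 0 = x.pos 0 ∧
      y.vOut 0 = x.vOut 0 ∧ (τ ∈ K → x.pos τ ∈ C.rim) ∧ Disjoint (K.erase τ) F := by
  by_cases hr : x.pos τ ∈ C.rim
  · have hneg := hx.inner_vIn_neg hτ hr (hv hr)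
    obtain ⟨y, e, K, hy, hy1, hy2, hy3⟩ := hC.escapes hr _ (neg_pos.2 hneg) τ F
    refine ⟨x.glue y τ, e, insert τ K, hy.glue hx hτ (fun t ht h => hno t ht (Or.inl h)) hy1.symm hr
      (rim_not_opening hr) (rim_not_arc hr) hneg.ne hy2, Track.glue_pos_of_le hτ.le,
      Track.glue_vOut_of_lt hτ, fun _ => hr, hy3.mono_left ?_⟩
    intro t ht
    rw [Finset.mem_erase, Finset.mem_insert] at ht
    exact ht.2.resolve_left ht.1
  · refine ⟨x, τ, ∅, ⟨hτ, hx, hend.resolve_left hr, fun t => ⟨fun h => ?_, fun h => ?_⟩, fun t h => ?_⟩,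
      rfl, rfl, fun h => ?_, ?_⟩
    · exact absurd h (Finset.notMem_empty t)
    · exact absurd (Or.inl h.2) (hno t h.1)
    · exact absurd h (Finset.notMem_empty t)
    · exact absurd h (Finset.notMem_empty τ)
    · simp

/-- The tracers of an admissible initial state can be given tours with distinct instants of
collision. -/
lemma OneControllable.exists_tours (hC : C.OneControllable) {n : ℕ} {ξ : CellState n}
    (hξ : C.AdmissibleInitial ξ) :
    ∃ (y : Fin n → Track) (d : Fin n → ℝ) (K : Fin n → Finset ℝ),
      (∀ i, C.Tour (y i) 0 (d i) (K i) ∧ (y i).pos 0 = ξ.pos i ∧ (y i).vOut 0 = ξ.vel i) ∧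
      ∀ i j, i ≠ j → Disjoint (K i) (K j) := by
  obtain ⟨-, τ, x, hx, hτ⟩ := hξ
  obtain ⟨a, ha, hdis⟩ := exists_disjoint_family
    (fun i (a : Track × ℝ × Finset ℝ) => C.Tour a.1 0 a.2.1 a.2.2 ∧ a.1.pos 0 = (x i).pos 0 ∧
      a.1.vOut 0 = (x i).vOut 0 ∧ (τ i ∈ a.2.2 → (x i).pos (τ i) ∈ C.rim))
    (fun i a => a.2.2.erase (τ i)) (fun i F => by
      obtain ⟨h1, -, -, h4, h5, h6, h7⟩ := hx i
      obtain ⟨y, d, K, g1, g2, g3, g4, g5⟩ := hC.exists_tour h1 h4 h5 h6 h7 F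
      exact ⟨(y, d, K), ⟨g1, g2, g3, g4⟩, g5⟩) (Finset.univ.image τ)
  refine ⟨fun i => (a i).1, fun i => (a i).2.1, fun i => (a i).2.2, fun i => ⟨(ha i).1.1, ?_, ?_⟩, ?_⟩
  · rw [(ha i).1.2.1, (hx i).2.1]
  · rw [(ha i).1.2.2.1, (hx i).2.2.1]
  intro i j hij
  rw [Finset.disjoint_left]
  intro t hti htj
  have hF : ∀ i l, t ∈ (a i).2.2 → t ≠ τ i → t ≠ τ l := by
    intro i l h1 h2 h3
    refine Finset.disjoint_left.1 (ha i).2 (Finset.mem_erase.2 ⟨h2, h1⟩) ?_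
    rw [h3]
    exact Finset.mem_image_of_mem τ (Finset.mem_univ l)
  by_cases h1 : t = τ i
  · by_cases h2 : t = τ j
    · refine hτ i j hij ((ha i).1.2.2.2 (h1 ▸ hti)) ((ha j).1.2.2.2 (h2 ▸ htj)) (h1.symm.trans h2)
    · exact hF j i htj h2 h1
  · by_cases h2 : t = τ j
    · exact hF i j hti h1 h2
    · exact Finset.disjoint_left.1 (hdis i j hij) (Finset.mem_erase.2 ⟨h1, hti⟩)
        (Finset.mem_erase.2 ⟨h2, htj⟩)

/-- An orbit made of tours with distinct instants of collision, for a disk that has the appropriate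
angular velocities before and after the collisions. -/
def Orbit.ofTours {ι : Type} (T : ℝ) (disk : DiskTrack) (track : ι → Track) (birth death : ι → ℝ)
    (K : ι → Finset ℝ) (hT : 0 < T) (hd : disk.Rotates T) (hb : ∀ i, 0 ≤ birth i)
    (hdT : ∀ i, death i ≤ T) (htour : ∀ i, C.Tour (track i) (birth i) (death i) (K i))
    (hdis : ∀ i j, i ≠ j → Disjoint (K i) (K j))
    (hin : ∀ i, ∀ t ∈ K i, inner ℝ ((track i).vOut t) (C.et ((track i).pos t)) = disk.wIn t)
    (hout : ∀ i, ∀ t ∈ K i, disk.wOut t = inner ℝ ((track i).vIn t) (C.et ((track i).pos t)))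
    (hno : ∀ t, (∀ i, t ∉ K i) → disk.wOut t = disk.wIn t) : C.Orbit ι where
  T := T
  disk := disk
  track := track
  birth := birth
  death := death
  T_pos := hT
  rotates := hd
  birth_nonneg := hb
  birth_lt_death i := (htour i).lt
  death_le := hdT
  moves i := (htour i).moves
  exits i := (htour i).exits
  collides i t ht hr := by
    have hK := ((htour i).hits t).2 ⟨ht, hr⟩
    have h := (htour i).bounces t hK
    refine ⟨h.1, ?_, hout i t hK⟩
    rw [← h.2, ← hin i t hK]
    exact eq_en_add_et hr _
  not_simultaneous i j hij t hi hj h := Finset.disjoint_left.1 (hdis i j hij)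
    (((htour i).hits t).2 ⟨hi, h.1⟩) (((htour j).hits t).2 ⟨hj, h.2⟩)
  inertia t _ h := hno t fun i hi => h i (((htour i).hits t).1 hi).1 (((htour i).hits t).1 hi).2

/-- Functions attached to disjoint sets have a common extension. -/
lemma exists_common_function {ι : Type*} {K : ι → Finset ℝ}
    (hdis : ∀ i j, i ≠ j → Disjoint (K i) (K j)) (f : ι → ℝ → ℝ) :
    ∃ g : ℝ → ℝ, ∀ i, ∀ t ∈ K i, g t = f i t := by
  classical
  refine ⟨fun t => if h : ∃ i, t ∈ K i then f h.choose t else 0, fun i t ht => ?_⟩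
  have h : ∃ i, t ∈ K i := ⟨i, ht⟩
  have hi : h.choose = i := by
    by_contra hne
    exact Finset.disjoint_left.1 (hdis _ _ hne) h.choose_spec ht
  simp only [dif_pos h, hi]

/-- A lead time for the drivers that is shorter than the gaps between the collisions. -/
lemma exists_gap (E : Finset ℝ) (hE : ∀ e ∈ E, 0 < e) :
    ∃ η > (0 : ℝ), ∀ e ∈ E, 2 * η < e ∧ ∀ e' ∈ E, e' < e → e' + 2 * η < e := by
  have hev : ∀ a : ℝ, 0 < a → ∀ᶠ η in 𝓝[>] (0 : ℝ), 2 * η < a := fun a ha =>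
    nhdsWithin_le_nhds ((by fun_prop : Continuous fun η : ℝ => 2 * η).continuousAt.eventually
      (gt_mem_nhds (by simpa using ha)))
  have h : ∀ᶠ η in 𝓝[>] (0 : ℝ), ∀ e ∈ E, 2 * η < e ∧ ∀ e' ∈ E, e' < e → e' + 2 * η < e := by
    rw [Filter.eventually_all_finset]
    intro e he
    refine (hev e (hE e he)).and ?_
    rw [Filter.eventually_all_finset]
    intro e' _
    by_cases hlt : e' < e
    · filter_upwards [hev (e - e') (sub_pos.2 hlt)] with η hη _
      linarith
    · exact Eventually.of_forall fun _ h => absurd h hlt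
  obtain ⟨η, hη, hη0⟩ := (h.and self_mem_nhdsWithin).exists
  exact ⟨η, hη0, hη⟩

end ScattererCell

theorem theorem1 (C : ScattererCell) (hC : C.OneControllable) (n : ℕ) (ξ : CellState n)
    (hξ : C.AdmissibleInitial ξ) :
    ∃ M : C.AdmissibleMovie n,
      M.orbit.disk.ang 0 = ξ.ang ∧ M.orbit.disk.wOut 0 = ξ.angVel ∧
      ∀ i, (M.path i).toFun 0 = ξ.pos i ∧ (M.orbit.track (Sum.inl i)).vOut 0 = ξ.vel i := by
  classical
  obtain ⟨y, d, K, hy, hdis⟩ := hC.exists_tours hξ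
  have hKd : ∀ i, ∀ t ∈ K i, t ∈ Ioo 0 (d i) := fun i t ht => (((hy i).1.hits t).1 ht).1
  -- the angular velocities that the tracers need and those that they leave
  obtain ⟨req, hreq⟩ := ScattererCell.exists_common_function hdis
    fun i t => inner ℝ ((y i).vOut t) (C.et ((y i).pos t))
  obtain ⟨post, hpost⟩ := ScattererCell.exists_common_function hdis
    fun i t => inner ℝ ((y i).vIn t) (C.et ((y i).pos t))
  set E : Finset ℝ := Finset.univ.biUnion K with hE
  have hEK : ∀ e, e ∈ E ↔ ∃ i, e ∈ K i := by simp [hE]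
  obtain ⟨η, hη, hgap⟩ := ScattererCell.exists_gap E fun e he => by
    obtain ⟨i, hi⟩ := (hEK e).1 he
    exact (hKd i e hi).1
  have hE2 : ∀ e ∈ E, e - η ∉ E := fun e he h => by
    have := (hgap e he).2 _ h (by linarith)
    linarith
  -- each collision of a tracer at a time `e` is prepared by a driver at the time `e - η`
  obtain ⟨disk, hrot, hang, hw0, hval, hinert, hconst⟩ := DiskTrack.exists_jumps ξ.ang ξ.angVel
    (E ∪ E.image (· - η)) (by
      intro t ht
      rcases Finset.mem_union.1 ht with h | h
      · linarith [(hgap t h).1]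
      · obtain ⟨e, he, rfl⟩ := Finset.mem_image.1 h
        linarith [(hgap e he).1])
    (fun t => if t ∈ E then post t else req (t + η))
  have hwE : ∀ e ∈ E, disk.wOut e = post e := fun e he => by
    rw [hval e (Finset.mem_union_left _ he), if_pos he]
  have hwD : ∀ e ∈ E, disk.wOut (e - η) = req e := fun e he => by
    rw [hval _ (Finset.mem_union_right _ (Finset.mem_image_of_mem _ he)), if_neg (hE2 e he),
      sub_add_cancel]
  have hwIn : ∀ e ∈ E, disk.wIn e = req e := fun e he => by
    rw [← hwD e he]
    refine hconst _ _ (by linarith) fun t ht hmem => ?_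
    rcases Finset.mem_union.1 ht with h | h
    · have := (hgap e he).2 t h hmem.2
      linarith [hmem.1]
    · obtain ⟨e', he', rfl⟩ := Finset.mem_image.1 h
      have := (hgap e' he').2 e he (by linarith [hmem.1])
      linarith [hmem.2]
  choose X δ hδ0 hδη hX hXstart hXdir hXout hXin using fun e : ℝ =>
    C.exists_driver (e - η) (disk.wIn (e - η)) (req e) hη
  set ev := E.equivFin.symm with hev
  have hevE : ∀ j, ((ev j : E) : ℝ) ∈ E := fun j => (ev j).2
  set T : ℝ := 1 + ∑ i, d i with hT
  have hd0 : ∀ i, 0 < d i := fun i => (hy i).1.lt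
  have hdT : ∀ i, d i ≤ T := fun i => by
    have := Finset.single_le_sum (f := d) (fun i _ => (hd0 i).le) (Finset.mem_univ i)
    linarith
  have hT0 : 0 < T := by
    have := Finset.sum_nonneg (f := d) (s := Finset.univ) fun i _ => (hd0 i).le
    linarith
  have hET : ∀ e ∈ E, e ≤ T := fun e he => by
    obtain ⟨i, hi⟩ := (hEK e).1 he
    exact (hKd i e hi).2.le.trans (hdT i)
  let orb : C.Orbit (Fin n ⊕ Fin E.card) := ScattererCell.Orbit.ofTours T disk
    (Sum.elim y fun j => X (ev j)) (Sum.elim (fun _ => 0) fun j => ev j - η - δ (ev j))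
    (Sum.elim d fun j => ev j - η + δ (ev j)) (Sum.elim K fun j => {(ev j : ℝ) - η})
    hT0 (hrot T)
    (by
      rintro (i | j)
      · exact le_rfl
      · have := (hgap _ (hevE j)).1
        have := hδη (ev j)
        simp only [Sum.elim_inr]
        linarith)
    (by
      rintro (i | j)
      · exact hdT i
      · have := hET _ (hevE j)
        have := hδη (ev j)
        simp only [Sum.elim_inr]
        linarith)
    (by
      rintro (i | j)
      · exact (hy i).1
      · exact hX (ev j))
    (by
      have hmix : ∀ i j, Disjoint (K i) {(ev j : ℝ) - η} := fun i j => by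
        rw [Finset.disjoint_singleton_right]
        exact fun h => hE2 _ (hevE j) ((hEK _).2 ⟨i, h⟩)
      rintro (i | j) (i' | j') hij
      · exact hdis i i' fun h => hij (h ▸ rfl)
      · exact hmix i j'
      · exact (hmix i' j).symm
      · simp only [Sum.elim_inr, Finset.disjoint_singleton]
        intro h
        refine hij (congrArg Sum.inr (ev.injective (Subtype.ext ?_)))
        linarith)
    (by
      rintro (i | j) t ht
      · exact (hreq i t ht).symm.trans (hwIn t ((hEK t).2 ⟨i, ht⟩)).symm
      · obtain rfl := Finset.mem_singleton.1 ht
        exact hXout (ev j))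
    (by
      rintro (i | j) t ht
      · exact (hwE t ((hEK t).2 ⟨i, ht⟩)).trans (hpost i t ht)
      · obtain rfl := Finset.mem_singleton.1 ht
        exact (hwD _ (hevE j)).trans (hXin (ev j)).symm)
    (by
      intro t ht
      refine hinert t fun h => ?_
      rcases Finset.mem_union.1 h with h | h
      · obtain ⟨i, hi⟩ := (hEK t).1 h
        exact ht (Sum.inl i) hi
      · obtain ⟨e, he, rfl⟩ := Finset.mem_image.1 h
        refine ht (Sum.inr (E.equivFin ⟨e, he⟩)) ?_
        simp [hev])
  have hstart : ∀ i, (y i).pos 0 ∉ C.rim := fun i h => by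
    rw [(hy i).2.1] at h
    exact (hξ.1 i).1.2 (Or.inr h)
  choose γ hγ v hv hγv using fun i => (hy i).1.exists_path
    (by rw [(hy i).2.2]; exact (hξ.1 i).2) (hstart i)
    (fun h => ScattererCell.rim_not_opening h (hy i).1.exits)
  refine ⟨{ path := γ
            drivers := E.card
            orbit := orb
            path_end := fun i => by rw [hγ, mul_one]; exact (hy i).1.exits
            tracer_birth := fun i => rfl
            tracer_start := fun i => by rw [hγ, mul_zero]; rfl
            tracer_direction := fun i => ⟨v i, hv i, hγv i⟩
            tracer_follows := fun i => ?_
            driver_injected := fun j => Or.inr ⟨hXstart (ev j), hXdir (ev j)⟩ },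
          hang, hw0, fun i => ⟨by rw [hγ, mul_zero]; exact (hy i).2.1, (hy i).2.2⟩⟩
  refine ⟨fun t => t / d i, by fun_prop, ?_, zero_div _, div_self (hd0 i).ne', fun t _ => ?_⟩
  · exact fun s _ t _ h => div_lt_div_of_pos_right h (hd0 i)
  · rw [hγ, mul_div_cancel₀ _ (hd0 i).ne']
    rfl
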